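/- **Setting.** Let $N\in\mathbb N=\{1,2,\dots\}$, let $(g_{ij})_{1\le i<j\le N}$ be independent standard Gaussians on a probability space, and set $g_{ji}=g_{ij}$ and $g_{ii}=0$. For a smooth function $F$ of the disorder write $\partial_{ij}F=\partial_{ji}F=\frac{dF}{dg_{ij}}$ for $i\neq j$, and put $\partial_{ii}F=0$. Let $\beta,h\in\mathbb R$, and let $\mathbf m^{(1)}\in[-1,1]^N$ be either deterministic or random and independent of $(g_{ij})$; put $\mathbf m^{(0)}=0$. For $k\ge1$ and $1\le i\le N$ define $$m_i^{(k+1)}=\tanh\Big(h+\frac{\beta}{\sqrt N}\sum_{j=1}^N g_{ij}m_j^{(k)}-\mathrm{On}_i^{(k)}\Big),$$ where, with $q_N^{(k)}=\frac1N\sum_{i=1}^N (m_i^{(k)})^2$, the correction is given (for all $k$ and $i$) by either one of the two choices $$\text{(I)}\quad \mathrm{On}_i^{(k)}=\beta^2\big(1-q_N^{(k)}\big)m_i^{(k-1)},\qquad\qquad \text{(II)}\quad \mathrm{On}_i^{(k)}=\frac{\beta}{\sqrt N}\sum_{j=1}^N\partial_{ij}m_j^{(k)} .$$ Derivatives are taken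 with $\mathbf m^{(1)}$ held fixed. For $x,y,z\in\{1,\dots,N\}$ define $$\Delta^{(k)}_{x;y,z}=\frac{\beta}{\sqrt N}\sum_{l=1}^N g_{xl}\,\partial_{yz}m_l^{(k)}-\partial_{yz}\mathrm{On}_x^{(k)},\qquad \mathcal E^{(k)}_x=\frac{\beta}{\sqrt N}\sum_{l\ne x}\partial_{xl}m_l^{(k)}-\mathrm{On}_x^{(k)} .$$ **Theorem.** For every $\beta\in\mathbb R$ and $k\in\mathbb N$ there exists a constant $C=C_{k,\beta}>0$ such that, for both choices (I) and (II), $$\mathbb E\Big[\big(\Delta^{(k)}_{x;y,z}\big)^2\Big]\le\frac{C}{N^2}\qquad\text{and}\qquad \mathbb E\Big[\big(\mathcal E^{(k)}_{x}\big)^2\Big]\le\frac{C}{N}$$ for all $h\in\mathbb R$, all $N\in\mathbb N$, all starting values $\mathbf m^{(1)}$ as above, and all $x,y,z\in\{1,\dots,N\}$ with $y\ne z$. -/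

import Mathlib

open MeasureTheory ProbabilityTheory

noncomputable section

namespace TAP

/-- The index set of the disorder: unordered pairs `{i, j}` of distinct sites. -/
abbrev Edge (N : ℕ) : Type := {e : Sym2 (Fin N) // ¬ e.IsDiag}

/-- The unordered pair `{i, j}` of two distinct sites. -/
def edge {N : ℕ} (i j : Fin N) (hij : i ≠ j) : Edge N :=
  ⟨s(i, j), fun hd => hij (Sym2.mk_isDiag_iff.mp hd)⟩

/-- A realization of the disorder: one real number for each unordered pair of distinct sites. -/
abbrev Disorder (N : ℕ) : Type := Edge N → ℝ

/-- The symmetric array `g i j` determined by the disorder, with zero diagonal. -/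
def coupling {N : ℕ} (g : Disorder N) (i j : Fin N) : ℝ :=
  if hij : i ≠ j then g (edge i j hij) else 0

/-- The partial derivative of `F` in the variable `g i j` (one variable for `{i, j}`),
which is zero by convention for `i = j`. -/
def pderiv {N : ℕ} (i j : Fin N) (F : Disorder N → ℝ) (g : Disorder N) : ℝ :=
  if hij : i ≠ j then lineDeriv ℝ F g (Pi.single (edge i j hij) 1) else 0

/-- The overlap `q_N(m)`, the average of the squares of the entries of `m`. -/
def overlap {N : ℕ} (m : Fin N → ℝ) : ℝ := (1 / (N : ℝ)) * ∑ i, m i ^ 2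

/-- The two choices of the Onsager correction. -/
inductive OnsagerChoice
  | classical
  | divergence

/-- The Onsager correction at site `i`, when the current iterate and the one before it are
the functions `cur` and `prev` of the disorder. -/
def onsagerOf {N : ℕ} (c : OnsagerChoice) (β : ℝ) (prev cur : Disorder N → Fin N → ℝ)
    (g : Disorder N) (i : Fin N) : ℝ :=
  match c with
  | .classical => β ^ 2 * (1 - overlap (cur g)) * prev g i
  | .divergence => β / √(N : ℝ) * ∑ j, pderiv i j (fun g' => cur g' j) g

/-- The iterates `m^(k)` as functions of the disorder, with `m^(0) = 0` and with starting value
`m^(1) = a`, which does not depend on the disorder. -/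
def mag {N : ℕ} (c : OnsagerChoice) (β h : ℝ) (a : Fin N → ℝ) :
    ℕ → Disorder N → Fin N → ℝ
  | 0 => fun _ _ => 0
  | 1 => fun _ => a
  | k + 2 => fun g i =>
      Real.tanh (h + (β / √(N : ℝ) * ∑ j, coupling g i j * mag c β h a (k + 1) g j
        - onsagerOf c β (mag c β h a k) (mag c β h a (k + 1)) g i))

/-- The Onsager correction `On^(k)` of the iteration at site `i`, for `k ≥ 1`. -/
def onsager {N : ℕ} (c : OnsagerChoice) (β h : ℝ) (a : Fin N → ℝ) (k : ℕ)
    (g : Disorder N) (i : Fin N) : ℝ :=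
  onsagerOf c β (mag c β h a (k - 1)) (mag c β h a k) g i

/-- The error term `Δ^(k)_{x; y, z}`. -/
def errorDelta {N : ℕ} (c : OnsagerChoice) (β h : ℝ) (a : Fin N → ℝ) (k : ℕ)
    (x y z : Fin N) (g : Disorder N) : ℝ :=
  β / √(N : ℝ) * ∑ l, coupling g x l * pderiv y z (fun g' => mag c β h a k g' l) g
    - pderiv y z (fun g' => onsager c β h a k g' x) g

/-- The error term `E^(k)_x`; the summand `l = x` vanishes because `pderiv x x = 0`. -/
def errorE {N : ℕ} (c : OnsagerChoice) (β h : ℝ) (a : Fin N → ℝ) (k : ℕ)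
    (x : Fin N) (g : Disorder N) : ℝ :=
  β / √(N : ℝ) * ∑ l, pderiv x l (fun g' => mag c β h a k g' l) g
    - onsager c β h a k g x

end TAP

end

noncomputable section

namespace TAP

open scoped ENNReal

/-! ### Functions of temperate growth and Gaussian moments -/

section TemperateGrowth

variable {E F : Type*} [NormedAddCommGroup E] [NormedSpace ℝ E]
  [NormedAddCommGroup F] [NormedSpace ℝ F]

/-! The sum `∑ l, g x l * ∂_{yz} m l` behaves like a stochastic integral once its Itô-type
correction `∑ l, ∂_{xl} ∂_{yz} m l` is subtracted. The result is a Gaussian divergence (Skorokhod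
integral), and the subtracted trace is what the derivative of the Onsager term should cancel. Hence
`errorDelta_eq`: `Δ = β N^(-1/2) δ_x(∂_{yz} m) + ∂_{yz} E_x`.

A divergence has the size of the `ℓ²` norm of its field, with no loss in `N`, provided the
derivatives of the field are small. Gaussian integration by parts gives `E[δ^(r+2)] = (r+1) E[δ^r
(energy + δ(self-advection))]` (`integral_divergence_pow`). For `r = 0` the last divergence has mean
zero; for higher moments it is a divergence of a field of squared size, controlled in half the
exponent. Induction over the exponents `2^p` gives all moments.

The invariant is localization: `∂_{yz} m j` has order `N^(-1/2)` for `j ∈ {y, z}` and `N^(-1)`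
elsewhere; each further derivative gains `N^(-1/2)` and makes its two endpoints exceptional as well.
Such a field has `ℓ²` norm of order `N^(-1/2)`, so `Δ` has order `1/N` as soon as `E`, with its
derivatives, has order `N^(-1/2)`.

The induction on `k` closes as follows. The derivative of the local field is `Δ` plus explicit terms
at the two endpoints, and `tanh` preserves the bounds (`IterateBounds.succ`). For choice (II), `E`
is zero by definition. For choice (I), inserting the derivative of `m` into `E` cancels the Onsager
term up to `O(1/N)` and leaves `N^(-1/2)` times a sum of `N` errors `Δ` of order `1/N`
(`errorE_classical`). A random start is treated by conditioning on it. -/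

theorem hasTemperateGrowth_fderiv {f : E → F} (hf : f.HasTemperateGrowth) :
    (fderiv ℝ f).HasTemperateGrowth := by
  refine ⟨hf.1.fderiv_right (m := ((⊤ : ℕ∞) : WithTop ℕ∞)) (by simp), fun n => ?_⟩
  obtain ⟨k, C, h⟩ := hf.2 (n + 1)
  exact ⟨k, C, fun x => by rw [norm_iteratedFDeriv_fderiv]; exact h x⟩

theorem hasTemperateGrowth_fderiv_apply {f : E → F} (hf : f.HasTemperateGrowth) (v : E) :
    (fun x => fderiv ℝ f x v).HasTemperateGrowth :=
  ((ContinuousLinearMap.apply ℝ F v).hasTemperateGrowth).comp (hasTemperateGrowth_fderiv hf)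

/-- Such a function is dominated by `C (1 + ‖x‖)^k`, and powers of `1 + ‖x‖` stay in every `L^q` by
Hölder with exponents `2q, 2q`. This settles every integrability question below. -/
theorem memLp_of_hasTemperateGrowth [MeasurableSpace E] [BorelSpace E]
    [SecondCountableTopology E] {μ : Measure E} [IsFiniteMeasure μ]
    (hμ : ∀ p : ℝ≥0∞, p ≠ ∞ → MemLp id p μ) {f : E → ℝ} (hf : f.HasTemperateGrowth)
    {p : ℝ≥0∞} (hp : p ≠ ∞) : MemLp f p μ := by
  obtain ⟨k, C, h⟩ := hf.2 0
  have h1 : ∀ q : ℝ≥0∞, q ≠ ∞ → MemLp (fun x : E => 1 + ‖x‖) q μ := fun q hq =>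
    (memLp_const (1 : ℝ)).add (hμ q hq).norm
  have h2 : ∀ (n : ℕ) (q : ℝ≥0∞), q ≠ ∞ → MemLp (fun x : E => (1 + ‖x‖) ^ n) q μ := by
    intro n
    induction n with
    | zero => intro q _; simpa using memLp_const (1 : ℝ)
    | succ n ih =>
      intro q hq
      have : (q * 2).HolderTriple (q * 2) q := ⟨by
        rw [ENNReal.mul_inv (by simp) (by simp), ← mul_add, ENNReal.inv_two_add_inv_two, mul_one]⟩
      have h3 : q * 2 ≠ ∞ := ENNReal.mul_ne_top hq (by simp)
      simpa [pow_succ] using! (h1 _ h3).mul (ih _ h3)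
  refine ((h2 k p hp).const_mul C).mono hf.1.continuous.aestronglyMeasurable
    (Filter.Eventually.of_forall fun x => ?_)
  have := h x
  rw [norm_iteratedFDeriv_zero] at this
  exact this.trans (le_abs_self _)

end TemperateGrowth

/-! ### Derivatives of the hyperbolic tangent -/

section Tanh

theorem one_sub_tanh_sq (x : ℝ) : 1 - Real.tanh x ^ 2 = 1 / Real.cosh x ^ 2 := by
  have h := (Real.cosh_pos x).ne'
  rw [Real.tanh_eq_sinh_div_cosh]
  field_simp
  linarith [Real.cosh_sq x]

theorem hasDerivAt_tanh (x : ℝ) : HasDerivAt Real.tanh (1 - Real.tanh x ^ 2) x := by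
  have h := (Real.cosh_pos x).ne'
  have h1 : Real.tanh = fun x => Real.sinh x / Real.cosh x :=
    funext Real.tanh_eq_sinh_div_cosh
  have h2 := (Real.hasDerivAt_sinh x).div (Real.hasDerivAt_cosh x) h
  rw [one_sub_tanh_sq, h1]
  convert! h2 using 1
  rw [← sq, ← sq, Real.cosh_sq]
  ring

/-- Since `tanh' = 1 - tanh²`, differentiation preserves polynomials in `tanh`; these are bounded
because `|tanh| < 1`. -/
theorem iteratedDeriv_tanh (n : ℕ) :
    ∃ P : Polynomial ℝ, iteratedDeriv n Real.tanh = fun x => P.eval (Real.tanh x) := by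
  induction n with
  | zero => exact ⟨Polynomial.X, by simp⟩
  | succ n ih =>
    obtain ⟨P, hP⟩ := ih
    refine ⟨Polynomial.derivative P * (1 - Polynomial.X ^ 2), ?_⟩
    ext x
    rw [iteratedDeriv_succ, hP]
    have h : HasDerivAt (fun x => P.eval (Real.tanh x)) _ x :=
      (P.hasDerivAt (Real.tanh x)).comp x (hasDerivAt_tanh x)
    rw [h.deriv]
    simp

theorem contDiff_tanh {n : WithTop ℕ∞} : ContDiff ℝ n Real.tanh := by
  rw [funext Real.tanh_eq_sinh_div_cosh]
  exact Real.contDiff_sinh.div Real.contDiff_cosh fun x => (Real.cosh_pos x).ne'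

theorem hasTemperateGrowth_tanh : Real.tanh.HasTemperateGrowth := by
  refine ⟨contDiff_tanh, fun n => ?_⟩
  obtain ⟨P, hP⟩ := iteratedDeriv_tanh n
  obtain ⟨C, hC⟩ := (isCompact_Icc (a := (-1 : ℝ)) (b := 1)).exists_bound_of_continuousOn
    P.continuous.continuousOn
  refine ⟨0, C, fun x => ?_⟩
  rw [norm_iteratedFDeriv_eq_norm_iteratedDeriv, hP]
  simpa using hC _ ⟨(Real.neg_one_lt_tanh x).le, (Real.tanh_lt_one x).le⟩

end Tanh

/-! ### Gaussian integration by parts -/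

section Stein

theorem gaussianPDFReal_std (t : ℝ) :
    gaussianPDFReal 0 1 t = (√(2 * Real.pi))⁻¹ * Real.exp (-(t ^ 2) / 2) := by
  simp [gaussianPDFReal]

theorem hasDerivAt_gaussianPDFReal (t : ℝ) :
    HasDerivAt (gaussianPDFReal 0 1) (-(t * gaussianPDFReal 0 1 t)) t := by
  have h : gaussianPDFReal 0 1 = fun t => (√(2 * Real.pi))⁻¹ * Real.exp (-(t ^ 2) / 2) :=
    funext gaussianPDFReal_std
  rw [h]
  have h1 : HasDerivAt (fun t : ℝ => -(t ^ 2) / 2) (-t) t := by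
    have := ((hasDerivAt_pow 2 t).neg).div_const 2
    convert! this using 1
    simp; ring
  convert! (h1.exp.const_mul (√(2 * Real.pi))⁻¹) using 1
  simp; ring

theorem integrable_gaussianPDFReal_mul {f : ℝ → ℝ} (hf : Integrable f (gaussianReal 0 1)) :
    Integrable (fun t => gaussianPDFReal 0 1 t * f t) := by
  rw [gaussianReal_of_var_ne_zero 0 one_ne_zero] at hf
  have h := (integrable_withDensity_iff_integrable_smul' (measurable_gaussianPDF 0 1)
    (Filter.Eventually.of_forall fun x => by simp [gaussianPDF])).1 hf
  simpa [toReal_gaussianPDF] using h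

theorem integrable_gaussianReal_of_hasTemperateGrowth {f : ℝ → ℝ}
    (hf : f.HasTemperateGrowth) : Integrable f (gaussianReal 0 1) :=
  memLp_one_iff_integrable.1
    (memLp_of_hasTemperateGrowth (fun p hp => memLp_id_gaussianReal' p hp) hf ENNReal.one_ne_top)

/-- The density satisfies `φ' = -t φ`, so this is integration by parts on the line; temperate growth
provides the integrability. -/
theorem stein_gaussianReal {f : ℝ → ℝ} (hf : f.HasTemperateGrowth) :
    ∫ t, t * f t ∂gaussianReal 0 1 = ∫ t, deriv f t ∂gaussianReal 0 1 := by
  have hd : (deriv f).HasTemperateGrowth := by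
    simpa only [fderiv_apply_one_eq_deriv] using hasTemperateGrowth_fderiv_apply hf (1 : ℝ)
  have hi : (fun t : ℝ => t * f t).HasTemperateGrowth :=
    Function.HasTemperateGrowth.id'.mul hf
  have key := integral_mul_deriv_eq_deriv_mul_of_integrable (A := ℝ)
    (u := f) (u' := deriv f) (v := gaussianPDFReal 0 1)
    (v' := fun t => -(t * gaussianPDFReal 0 1 t))
    (fun x _ => (hf.1.differentiable (by simp) x).hasDerivAt)
    (fun x _ => hasDerivAt_gaussianPDFReal x)
    ?_ ?_ ?_
  · rw [integral_gaussianReal_eq_integral_smul one_ne_zero,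
      integral_gaussianReal_eq_integral_smul one_ne_zero]
    simp only [smul_eq_mul]
    have h1 : ∀ t, f t * -(t * gaussianPDFReal 0 1 t) = -(gaussianPDFReal 0 1 t * (t * f t)) :=
      fun t => by ring
    simp only [h1, integral_neg, neg_inj] at key
    rw [key]
    exact integral_congr_ae (Filter.Eventually.of_forall fun t => mul_comm _ _)
  · refine ((integrable_gaussianPDFReal_mul
      (integrable_gaussianReal_of_hasTemperateGrowth hi)).neg).congr
      (Filter.Eventually.of_forall fun t => ?_)
    simp; ring
  · refine ((integrable_gaussianPDFReal_mul
      (integrable_gaussianReal_of_hasTemperateGrowth hd))).congr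
      (Filter.Eventually.of_forall fun t => ?_)
    simp; ring
  · refine ((integrable_gaussianPDFReal_mul
      (integrable_gaussianReal_of_hasTemperateGrowth hf))).congr
      (Filter.Eventually.of_forall fun t => ?_)
    simp; ring

variable (ι : Type*) [Fintype ι]

/-- The standard Gaussian measure on `ι → ℝ`. -/
def stdGauss : Measure (ι → ℝ) := Measure.pi fun _ => gaussianReal 0 1

instance : IsProbabilityMeasure (stdGauss ι) := by
  unfold stdGauss; infer_instance

variable {ι}

theorem memLp_id_stdGauss {p : ℝ≥0∞} (hp : p ≠ ∞) : MemLp id p (stdGauss ι) := by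
  have h1 : ∀ i : ι, MemLp (fun x : ι → ℝ => x i) p (stdGauss ι) := fun i =>
    (memLp_id_gaussianReal' p hp).comp_measurePreserving
      (measurePreserving_eval (fun _ : ι => gaussianReal 0 1) i)
  have h2 : MemLp (fun x : ι → ℝ => ∑ i, ‖x i‖) p (stdGauss ι) :=
    memLp_finsetSum _ fun i _ => (h1 i).norm
  refine h2.mono continuous_id.aestronglyMeasurable (Filter.Eventually.of_forall fun x => ?_)
  have h3 : 0 ≤ ∑ i, ‖x i‖ := Finset.sum_nonneg fun i _ => norm_nonneg _
  rw [Real.norm_of_nonneg h3, id, pi_norm_le_iff_of_nonneg h3]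
  exact fun i => Finset.single_le_sum (f := fun i => ‖x i‖) (fun j _ => norm_nonneg _)
    (Finset.mem_univ i)

theorem memLp_stdGauss {f : (ι → ℝ) → ℝ} (hf : f.HasTemperateGrowth) {p : ℝ≥0∞} (hp : p ≠ ∞) :
    MemLp f p (stdGauss ι) :=
  memLp_of_hasTemperateGrowth (fun _ hp => memLp_id_stdGauss hp) hf hp

theorem integrable_stdGauss {f : (ι → ℝ) → ℝ} (hf : f.HasTemperateGrowth) :
    Integrable f (stdGauss ι) :=
  memLp_one_iff_integrable.1 (memLp_stdGauss hf ENNReal.one_ne_top)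

variable [DecidableEq ι]

/-- Resampling one coordinate leaves the product measure invariant. This isolates a coordinate for
Fubini without splitting the index set. -/
theorem measurePreserving_update (e : ι) :
    MeasurePreserving (fun q : (ι → ℝ) × ℝ => Function.update q.1 e q.2)
      ((stdGauss ι).prod (gaussianReal 0 1)) (stdGauss ι) := by
  have hm : Measurable (fun q : (ι → ℝ) × ℝ => Function.update q.1 e q.2) :=
    measurable_update'
  refine ⟨hm, (Measure.pi_eq fun s hs => ?_).symm⟩
  rw [Measure.map_apply hm (MeasurableSet.univ_pi hs)]
  -- The old value at `e` is discarded, so its constraint becomes `Set.univ` and passes to the new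
  -- variable.
  have h1 : (fun q : (ι → ℝ) × ℝ => Function.update q.1 e q.2) ⁻¹' Set.univ.pi s
      = (Set.univ.pi (Function.update s e Set.univ)) ×ˢ s e := by
    ext q
    simp only [Set.mem_preimage, Set.mem_pi, Set.mem_univ, true_imp_iff, Set.mem_prod]
    constructor
    · intro h
      refine ⟨fun i => ?_, by simpa using h e⟩
      by_cases hi : i = e
      · subst hi; simp
      · simpa [hi] using h i
    · rintro ⟨h, h'⟩ i
      by_cases hi : i = e
      · subst hi; simpa using h'
      · simpa [hi] using h i
  rw [h1, Measure.prod_prod, stdGauss, Measure.pi_pi, 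
    ← Finset.prod_erase_mul Finset.univ
      (fun i => (gaussianReal 0 1) (Function.update s e Set.univ i)) (Finset.mem_univ e),
    ← Finset.prod_erase_mul Finset.univ (fun i => (gaussianReal 0 1) (s i))
      (Finset.mem_univ e)]
  congr 1
  rw [Function.update_self, measure_univ, mul_one]
  exact Finset.prod_congr rfl fun i hi => by
    rw [Function.update_of_ne (Finset.ne_of_mem_erase hi)]

/-- Resample coordinate `e`, freeze the others by Fubini, and apply the one-dimensional identity
along the line `t ↦ update x e t`. -/
theorem stein_stdGauss {f : (ι → ℝ) → ℝ} (hf : f.HasTemperateGrowth) (e : ι) :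
    ∫ x, x e * f x ∂stdGauss ι = ∫ x, fderiv ℝ f x (Pi.single e 1) ∂stdGauss ι := by
  have hmp := measurePreserving_update (ι := ι) e
  have h1 : (fun x : ι → ℝ => x e * f x).HasTemperateGrowth :=
    ((ContinuousLinearMap.proj (R := ℝ) (φ := fun _ : ι => ℝ) e).hasTemperateGrowth).mul hf
  have h2 := hasTemperateGrowth_fderiv_apply hf (Pi.single e (1 : ℝ))
  have i1 := integrable_stdGauss h1
  have i2 := integrable_stdGauss h2
  rw [← hmp.map_eq] at i1 i2
  rw [← hmp.map_eq, integral_map hmp.aemeasurable i1.aestronglyMeasurable,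
    integral_map hmp.aemeasurable i2.aestronglyMeasurable]
  rw [hmp.map_eq] at i1 i2
  have j1 := integral_prod _ (hmp.integrable_comp_of_integrable i1)
  have j2 := integral_prod _ (hmp.integrable_comp_of_integrable i2)
  simp only [Function.comp_apply] at j1 j2
  rw [j1, j2]
  refine integral_congr_ae (Filter.Eventually.of_forall fun x => ?_)
  have hu : ∀ t : ℝ, Function.update x e t = Function.update x e 0 + t • Pi.single e (1 : ℝ) := by
    intro t
    ext i
    by_cases hi : i = e
    · subst hi; simp
    · simp [hi]
  set φ : ℝ → (ι → ℝ) := fun t => Function.update x e t with hφ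
  have hφd : ∀ t, HasDerivAt φ (Pi.single e (1 : ℝ)) t := by
    intro t
    have : φ = fun t => Function.update x e 0 + t • Pi.single e (1 : ℝ) := funext hu
    rw [this]
    simpa using ((hasDerivAt_id t).smul_const (Pi.single e (1 : ℝ))).const_add
      (Function.update x e 0)
  have hφt : φ.HasTemperateGrowth := by
    have : φ = fun t => Function.update x e 0 + t • Pi.single e (1 : ℝ) := funext hu
    rw [this]
    exact (Function.HasTemperateGrowth.const _).add
      (Function.HasTemperateGrowth.id'.smul (Function.HasTemperateGrowth.const _))
  have hst := stein_gaussianReal (hf.comp hφt)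
  have hder : ∀ t, deriv (f ∘ φ) t = fderiv ℝ f (φ t) (Pi.single e 1) := fun t =>
    ((hf.1.differentiable (by simp) (φ t)).hasFDerivAt.comp_hasDerivAt t (hφd t)).deriv
  simp only [hder, Function.comp_apply] at hst
  simpa [hφ] using hst

end Stein

/-! ### Calculus of the partial derivatives in the disorder -/

section PartialDerivatives

variable {N : ℕ} {F G : Disorder N → ℝ}

/-- The coordinate direction of the disorder variable `g i j`, zero if `i = j`. -/
def direction (i j : Fin N) : Disorder N :=
  if hij : i ≠ j then Pi.single (edge i j hij) 1 else 0

theorem pderiv_eq_fderiv (hF : Differentiable ℝ F) (i j : Fin N) (g : Disorder N) :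
    pderiv i j F g = fderiv ℝ F g (direction i j) := by
  unfold pderiv direction
  split_ifs with h
  · exact (hF g).lineDeriv_eq_fderiv
  · simp

theorem HasTemperateGrowth.differentiable (hF : F.HasTemperateGrowth) : Differentiable ℝ F :=
  hF.1.differentiable (by simp)

theorem HasTemperateGrowth.pderiv (hF : F.HasTemperateGrowth) (i j : Fin N) :
    (pderiv i j F).HasTemperateGrowth := by
  have : TAP.pderiv i j F = fun g => fderiv ℝ F g (direction i j) :=
    funext fun g => pderiv_eq_fderiv (HasTemperateGrowth.differentiable hF) i j g
  rw [this]
  exact hasTemperateGrowth_fderiv_apply hF _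

theorem hasTemperateGrowth_coupling (i j : Fin N) :
    (fun g : Disorder N => coupling g i j).HasTemperateGrowth := by
  unfold coupling
  split_ifs with h
  · exact (ContinuousLinearMap.proj (R := ℝ) (φ := fun _ : Edge N => ℝ)
      (edge i j h)).hasTemperateGrowth
  · exact Function.HasTemperateGrowth.const _

theorem pderiv_const (i j : Fin N) (c : ℝ) (g : Disorder N) :
    pderiv i j (fun _ => c) g = 0 := by
  rw [pderiv_eq_fderiv (differentiable_const c)]
  simp

theorem pderiv_add (hF : F.HasTemperateGrowth) (hG : G.HasTemperateGrowth) (i j : Fin N) :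
    pderiv i j (fun g => F g + G g) = fun g => pderiv i j F g + pderiv i j G g := by
  have dF := HasTemperateGrowth.differentiable hF
  have dG := HasTemperateGrowth.differentiable hG
  ext g
  rw [pderiv_eq_fderiv (dF.fun_add dG), pderiv_eq_fderiv dF, pderiv_eq_fderiv dG,
    fderiv_fun_add (dF g) (dG g)]
  rfl

theorem pderiv_sub (hF : F.HasTemperateGrowth) (hG : G.HasTemperateGrowth) (i j : Fin N) :
    pderiv i j (fun g => F g - G g) = fun g => pderiv i j F g - pderiv i j G g := by
  have dF := HasTemperateGrowth.differentiable hF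
  have dG := HasTemperateGrowth.differentiable hG
  ext g
  rw [pderiv_eq_fderiv (dF.fun_sub dG), pderiv_eq_fderiv dF, pderiv_eq_fderiv dG,
    fderiv_fun_sub (dF g) (dG g)]
  rfl

theorem pderiv_mul (hF : F.HasTemperateGrowth) (hG : G.HasTemperateGrowth) (i j : Fin N) :
    pderiv i j (fun g => F g * G g) = fun g => pderiv i j F g * G g + F g * pderiv i j G g := by
  have dF := HasTemperateGrowth.differentiable hF
  have dG := HasTemperateGrowth.differentiable hG
  ext g
  rw [pderiv_eq_fderiv (dF.fun_mul dG), pderiv_eq_fderiv dF, pderiv_eq_fderiv dG,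
    fderiv_fun_mul (dF g) (dG g)]
  simp
  ring

theorem pderiv_const_mul (hF : F.HasTemperateGrowth) (c : ℝ) (i j : Fin N) :
    pderiv i j (fun g => c * F g) = fun g => c * pderiv i j F g := by
  rw [pderiv_mul (Function.HasTemperateGrowth.const c) hF]
  ext g
  rw [pderiv_const]
  ring

theorem pderiv_sum {ι : Type*} (s : Finset ι) {F : ι → Disorder N → ℝ}
    (hF : ∀ a, (F a).HasTemperateGrowth) (i j : Fin N) :
    pderiv i j (fun g => ∑ a ∈ s, F a g) = fun g => ∑ a ∈ s, pderiv i j (F a) g := by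
  classical
  induction s using Finset.induction_on with
  | empty => ext g; simp [pderiv_const]
  | insert a s ha ih =>
    simp only [Finset.sum_insert ha]
    rw [pderiv_add (hF a) (Function.HasTemperateGrowth.sum fun b _ => hF b), ih]

theorem pderiv_comp {φ φ' : ℝ → ℝ} (hφ : ∀ x, HasDerivAt φ (φ' x) x)
    (hF : F.HasTemperateGrowth) (i j : Fin N) :
    pderiv i j (fun g => φ (F g)) = fun g => φ' (F g) * pderiv i j F g := by
  have dF := HasTemperateGrowth.differentiable hF
  have h : ∀ g, HasFDerivAt (fun g => φ (F g)) (φ' (F g) • fderiv ℝ F g) g := fun g =>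
    (hφ (F g)).comp_hasFDerivAt g (dF g).hasFDerivAt
  ext g
  rw [pderiv_eq_fderiv fun g => (h g).differentiableAt, pderiv_eq_fderiv dF, (h g).fderiv]
  rfl

theorem pderiv_pow (hF : F.HasTemperateGrowth) (n : ℕ) (i j : Fin N) :
    pderiv i j (fun g => F g ^ n) = fun g => n * F g ^ (n - 1) * pderiv i j F g :=
  pderiv_comp (φ := fun x => x ^ n) (fun x => hasDerivAt_pow n x) hF i j

theorem edge_eq_edge_iff {i j k l : Fin N} (hij : i ≠ j) (hkl : k ≠ l) :
    edge i j hij = edge k l hkl ↔ (i = k ∧ j = l) ∨ (i = l ∧ j = k) := by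
  simp [edge]

theorem pderiv_coupling (i j k l : Fin N) (g : Disorder N) :
    pderiv i j (fun g => coupling g k l) g =
      if i ≠ j ∧ ((k = i ∧ l = j) ∨ (k = j ∧ l = i)) then 1 else 0 := by
  rw [pderiv_eq_fderiv (HasTemperateGrowth.differentiable (hasTemperateGrowth_coupling k l))]
  by_cases hkl : k = l
  · subst hkl
    have : (fun g : Disorder N => coupling g k k) = fun _ => 0 := by ext g; simp [coupling]
    rw [this, if_neg (by rintro ⟨h, ⟨h1, h2⟩ | ⟨h1, h2⟩⟩ <;> exact h (by rw [← h1, ← h2]))]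
    simp
  · have : (fun g : Disorder N => coupling g k l) =
        ContinuousLinearMap.proj (R := ℝ) (φ := fun _ : Edge N => ℝ) (edge k l hkl) := by
      ext g; simp [coupling, hkl]
    rw [this, ContinuousLinearMap.fderiv]
    unfold direction
    by_cases hij : i = j
    · simp [hij]
    · simp only [ne_eq, hij, not_false_eq_true, dite_true, true_and,
        ContinuousLinearMap.proj_apply, Pi.single_apply, edge_eq_edge_iff]

/-- Symmetry of the second derivative; it lets `∂_{xy}` pass through the trace term of a divergence.
-/
theorem pderiv_comm (hF : F.HasTemperateGrowth) (i j k l : Fin N) :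
    pderiv i j (pderiv k l F) = pderiv k l (pderiv i j F) := by
  have dF := HasTemperateGrowth.differentiable hF
  have h1 : ∀ a b : Fin N, pderiv a b F = fun g => fderiv ℝ F g (direction a b) := fun a b =>
    funext fun g => pderiv_eq_fderiv dF a b g
  have dF' : Differentiable ℝ (fderiv ℝ F) :=
    (hasTemperateGrowth_fderiv hF).1.differentiable (by simp)
  have h2 : ∀ a b c d : Fin N, ∀ g, pderiv a b (pderiv c d F) g =
      fderiv ℝ (fderiv ℝ F) g (direction a b) (direction c d) := by
    intro a b c d g
    rw [pderiv_eq_fderiv (HasTemperateGrowth.differentiable (HasTemperateGrowth.pderiv hF c d)),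
      h1 c d, fderiv_clm_apply (dF' g) (differentiableAt_const _)]
    simp
  ext g
  rw [h2, h2]
  have : IsSymmSndFDerivAt ℝ F g := 
    hF.1.contDiffAt.isSymmSndFDerivAt 
      (by simpa using WithTop.coe_le_coe.2 (le_top : (2 : ℕ∞) ≤ ⊤))
  exact this _ _

variable (N) in
/-- The law of the disorder. -/
abbrev gauss : Measure (Disorder N) := stdGauss (Edge N)

theorem integral_coupling_mul (hF : F.HasTemperateGrowth) (i j : Fin N) :
    ∫ g, coupling g i j * F g ∂gauss N = ∫ g, pderiv i j F g ∂gauss N := by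
  simp only [pderiv_eq_fderiv (HasTemperateGrowth.differentiable hF)]
  by_cases h : i = j
  · subst h; simp [coupling, direction]
  · simpa [coupling, direction, h] using stein_stdGauss hF (edge i j h)

end PartialDerivatives

/-! ### The norms of `L^(2^p)`; Hölder raises `p` by one -/

section LpNorm

variable {N : ℕ} {F G : Disorder N → ℝ}

/-- The norm of `L^q` with `q = 2 ^ p`. -/
def nrm (p : ℕ) (F : Disorder N → ℝ) : ℝ := lpNorm F (2 ^ p) (gauss N)

theorem two_pow_ne_top (p : ℕ) : (2 ^ p : ℝ≥0∞) ≠ ∞ := by simp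

theorem one_le_two_pow_ennreal (p : ℕ) : (1 : ℝ≥0∞) ≤ 2 ^ p := one_le_pow₀ (by norm_num)

theorem memLp_two_pow (hF : F.HasTemperateGrowth) (p : ℕ) : MemLp F (2 ^ p) (gauss N) :=
  memLp_stdGauss hF (two_pow_ne_top p)

theorem nrm_nonneg (p : ℕ) (F : Disorder N → ℝ) : 0 ≤ nrm p F := lpNorm_nonneg

theorem nrm_add_le (hF : F.HasTemperateGrowth) (p : ℕ) :
    nrm p (fun g => F g + G g) ≤ nrm p F + nrm p G :=
  lpNorm_add_le (memLp_two_pow hF p) (one_le_two_pow_ennreal p)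

theorem nrm_sum_le {ι : Type*} (s : Finset ι) {F : ι → Disorder N → ℝ}
    (hF : ∀ a, (F a).HasTemperateGrowth) (p : ℕ) :
    nrm p (fun g => ∑ a ∈ s, F a g) ≤ ∑ a ∈ s, nrm p (F a) := by
  have := lpNorm_sum_le (s := s) (f := F) (fun a _ => memLp_two_pow (hF a) p)
    (one_le_two_pow_ennreal p)
  convert! this using 1
  unfold nrm
  congr 1
  ext g
  simp

theorem nrm_const_mul (c : ℝ) (p : ℕ) : nrm p (fun g => c * F g) = |c| * nrm p F := by
  have := lpNorm_const_smul (p := 2 ^ p) c F (gauss N)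
  simpa [nrm] using! this

theorem nrm_const (p : ℕ) (c : ℝ) : nrm p (fun _ : Disorder N => c) = |c| := by
  unfold nrm
  rw [lpNorm_const' (by simp) (by simp)]
  simp

theorem nrm_mul_le (hF : F.HasTemperateGrowth) (hG : G.HasTemperateGrowth) (p : ℕ) :
    nrm p (fun g => F g * G g) ≤ nrm (p + 1) F * nrm (p + 1) G := by
  have hh : ((2 : ℝ≥0∞) ^ (p + 1)).HolderTriple (2 ^ (p + 1)) (2 ^ p) := ⟨by
    rw [pow_succ, ENNReal.mul_inv (by simp) (by simp), ← mul_add, ENNReal.inv_two_add_inv_two,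
      mul_one]⟩
  have mF := memLp_two_pow hF (p + 1)
  have mG := memLp_two_pow hG (p + 1)
  have h := eLpNorm_smul_le_mul_eLpNorm (p := 2 ^ (p + 1)) (q := 2 ^ (p + 1)) (r := 2 ^ p)
    mG.1 mF.1
  have h2 := ENNReal.toReal_mono (ENNReal.mul_ne_top mF.2.ne mG.2.ne) h
  rw [ENNReal.toReal_mul, toReal_eLpNorm mF.1, toReal_eLpNorm mG.1,
    toReal_eLpNorm (mF.1.smul mG.1)] at h2
  exact h2

theorem nrm_le_of_le {p q : ℕ} (hpq : p ≤ q) (hF : F.HasTemperateGrowth) : nrm p F ≤ nrm q F := by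
  have mp := memLp_two_pow hF p
  have mq := memLp_two_pow hF q
  have h := eLpNorm_le_eLpNorm_of_exponent_le (μ := gauss N)
    (p := 2 ^ p) (q := 2 ^ q) (pow_le_pow_right₀ (by norm_num) hpq) mp.1
  have h2 := ENNReal.toReal_mono mq.2.ne h
  rwa [toReal_eLpNorm mp.1, toReal_eLpNorm mq.1] at h2

theorem nrm_pow (hF : F.HasTemperateGrowth) (p : ℕ) :
    nrm p F ^ 2 ^ p = ∫ g, |F g| ^ 2 ^ p ∂gauss N := by
  unfold nrm
  rw [lpNorm_eq_integral_norm_rpow_toReal (by simp) (by simp) (memLp_two_pow hF p).1]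
  have h : ((2 : ℝ≥0∞) ^ p).toReal = ((2 ^ p : ℕ) : ℝ) := by simp
  rw [h, ← Real.rpow_natCast, ← Real.rpow_mul (integral_nonneg fun g => by positivity),
    inv_mul_cancel₀ (by positivity), Real.rpow_one]
  simp only [Real.rpow_natCast, Real.norm_eq_abs]

theorem nrm_le_of_bounded (hF : F.HasTemperateGrowth) {C : ℝ} (h : ∀ g, |F g| ≤ C) (p : ℕ) :
    nrm p F ≤ C := by
  have hC : 0 ≤ C := (abs_nonneg _).trans (h 0)
  refine le_of_pow_le_pow_left₀ (n := 2 ^ p) (by positivity) hC ?_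
  rw [nrm_pow hF]
  calc ∫ g, |F g| ^ 2 ^ p ∂gauss N ≤ ∫ _, C ^ 2 ^ p ∂gauss N := by
        refine integral_mono_of_nonneg (Filter.Eventually.of_forall fun g => by positivity)
          (integrable_const _) (Filter.Eventually.of_forall fun g => ?_)
        exact pow_le_pow_left₀ (abs_nonneg _) (h g) _
    _ = C ^ 2 ^ p := by simp

end LpNorm

/-! ### The Gaussian divergence and its moment identity -/

section Divergence

variable {N : ℕ}

/-- The Gaussian divergence (Skorokhod integral) of the vector field `u` in the directions of the
disorder variables `g l j`. -/
def divergence (l : Fin N) (u : Fin N → Disorder N → ℝ) (g : Disorder N) : ℝ :=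
  ∑ j, (coupling g l j * u j g - pderiv l j (u j) g)

/-- The derivative of the vector field `u` in its own direction. -/
def selfAdvection (l : Fin N) (u : Fin N → Disorder N → ℝ) (i : Fin N) (g : Disorder N) : ℝ :=
  ∑ j, u j g * pderiv l j (u i) g

/-- The integrand in the formula for the second moment of the divergence. -/
def energyDensity (l : Fin N) (u : Fin N → Disorder N → ℝ) (g : Disorder N) : ℝ :=
  (∑ j, if l ≠ j then u j g * u j g else 0)
    + ∑ j, ∑ i, pderiv l i (u j) g * pderiv l j (u i) g

/-- The coupling `g l j` depends on the variable `{x, y}` only if `{l, j} = {x, y}`, so at most one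
`j` survives. -/
theorem sum_indicator_mul (l x y : Fin N) (v : Fin N → ℝ) :
    ∑ j, (if x ≠ y ∧ ((l = x ∧ j = y) ∨ (l = y ∧ j = x)) then (1 : ℝ) else 0) * v j =
      if x ≠ y then (if l = x then v y else 0) + (if l = y then v x else 0) else 0 := by
  by_cases hxy : x = y
  · simp [hxy]
  · have h2 : ∀ j, (if x ≠ y ∧ ((l = x ∧ j = y) ∨ (l = y ∧ j = x)) then (1 : ℝ) else 0) * v j =
        (if j = y then (if l = x then v j else 0) else 0)
        + (if j = x then (if l = y then v j else 0) else 0) := by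
      intro j
      by_cases h3 : l = x
      · have h4 : l ≠ y := fun h => hxy (h3.symm.trans h)
        simp [hxy, h3]
      · simp [h3, hxy, ← ite_and, and_comm]
    simp only [h2, Finset.sum_add_distrib]
    simp [hxy]

variable {u : Fin N → Disorder N → ℝ} (hu : ∀ j, (u j).HasTemperateGrowth)
include hu

theorem hasTemperateGrowth_divergence_term (l j : Fin N) :
    (fun g => coupling g l j * u j g - pderiv l j (u j) g).HasTemperateGrowth :=
  ((hasTemperateGrowth_coupling l j).mul (hu j)).sub (HasTemperateGrowth.pderiv (hu j) l j)

theorem hasTemperateGrowth_divergence (l : Fin N) : (divergence l u).HasTemperateGrowth :=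
  Function.HasTemperateGrowth.sum fun j _ => hasTemperateGrowth_divergence_term hu l j

theorem hasTemperateGrowth_selfAdvection (l i : Fin N) :
    (selfAdvection l u i).HasTemperateGrowth :=
  Function.HasTemperateGrowth.sum fun j _ => (hu j).mul (HasTemperateGrowth.pderiv (hu i) l j)

theorem hasTemperateGrowth_energyDensity (l : Fin N) : (energyDensity l u).HasTemperateGrowth := by
  refine Function.HasTemperateGrowth.add (Function.HasTemperateGrowth.sum fun j _ => ?_)
    (Function.HasTemperateGrowth.sum fun j _ => Function.HasTemperateGrowth.sum fun i _ =>
      (HasTemperateGrowth.pderiv (hu j) l i).mul (HasTemperateGrowth.pderiv (hu i) l j))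
  split_ifs
  · exact (hu j).mul (hu j)
  · exact Function.HasTemperateGrowth.const _

/-- Commutation relation of derivative and divergence: the extra term arises when the derivative
hits a coupling. -/
theorem pderiv_divergence (l x y : Fin N) :
    pderiv x y (divergence l u) = fun g => divergence l (fun j => pderiv x y (u j)) g +
      if x ≠ y then (if l = x then u y g else 0) + (if l = y then u x g else 0) else 0 := by
  unfold divergence
  rw [pderiv_sum _ (hasTemperateGrowth_divergence_term hu l)]
  ext g
  have h1 : ∀ j, pderiv x y (fun g => coupling g l j * u j g - pderiv l j (u j) g) g =
      (coupling g l j * pderiv x y (u j) g - pderiv l j (pderiv x y (u j)) g)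
      + (if x ≠ y ∧ ((l = x ∧ j = y) ∨ (l = y ∧ j = x)) then 1 else 0) * u j g := by
    intro j
    rw [pderiv_sub ((hasTemperateGrowth_coupling l j).fun_mul (hu j))
      (HasTemperateGrowth.pderiv (hu j) l j),
      pderiv_mul (hasTemperateGrowth_coupling l j) (hu j), pderiv_comm (hu j) x y l j]
    simp only [pderiv_coupling]
    ring
  simp only [h1, Finset.sum_add_distrib]
  congr 1
  exact sum_indicator_mul l x y fun j => u j g

/-- The divergence is adjoint to the gradient: integration by parts produces `∂(u F)`, and the
subtracted `∂u` cancels one half of the product rule. -/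
theorem integral_divergence_mul (l : Fin N) {F : Disorder N → ℝ} (hF : F.HasTemperateGrowth) :
    ∫ g, divergence l u g * F g ∂gauss N = ∫ g, ∑ j, u j g * pderiv l j F g ∂gauss N := by
  have h1 : ∀ j, (fun g => coupling g l j * (u j g * F g)).HasTemperateGrowth := fun j =>
    (hasTemperateGrowth_coupling l j).mul ((hu j).mul hF)
  have h2 : ∀ j, (fun g => pderiv l j (u j) g * F g).HasTemperateGrowth := fun j =>
    (HasTemperateGrowth.pderiv (hu j) l j).mul hF
  have h3 : ∀ j, (fun g => u j g * pderiv l j F g).HasTemperateGrowth := fun j =>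
    (hu j).mul (HasTemperateGrowth.pderiv hF l j)
  have h4 : ∀ g, divergence l u g * F g =
      ∑ j, (coupling g l j * (u j g * F g) - pderiv l j (u j) g * F g) := by
    intro g
    rw [divergence, Finset.sum_mul]
    exact Finset.sum_congr rfl fun j _ => by ring
  simp only [h4]
  rw [integral_finsetSum _ fun j _ => integrable_stdGauss ((h1 j).fun_sub (h2 j)),
    integral_finsetSum _ fun j _ => integrable_stdGauss (h3 j)]
  refine Finset.sum_congr rfl fun j _ => ?_
  rw [integral_sub (integrable_stdGauss (h1 j)) (integrable_stdGauss (h2 j)),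
    integral_coupling_mul ((hu j).fun_mul hF), pderiv_mul (hu j) hF,
    integral_add (integrable_stdGauss (h2 j)) (integrable_stdGauss (h3 j))]
  ring

/-- By the commutation relation the left side is `∑ u_j² + ∑ u_j δ(∂_j u)`, with `j ≠ l` in the
first sum. Pulling `u_j` inside the divergence costs `∑ ∂_i u_j ∂_j u_i`, and what remains is the
divergence of the self-advection. -/
theorem sum_mul_pderiv_divergence (l : Fin N) (g : Disorder N) :
    ∑ j, u j g * pderiv l j (divergence l u) g =
      energyDensity l u g + divergence l (selfAdvection l u) g := by
  have h1 : ∀ j, pderiv l j (divergence l u) g =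
      divergence l (fun i => pderiv l j (u i)) g + if l ≠ j then u j g else 0 := by
    intro j
    rw [pderiv_divergence hu]
    by_cases h : l = j
    · simp [h]
    · simp [h]
  have h2 : ∀ i, pderiv l i (selfAdvection l u i) g =
      ∑ j, (pderiv l i (u j) g * pderiv l j (u i) g + u j g * pderiv l i (pderiv l j (u i)) g) := by
    intro i
    unfold selfAdvection
    rw [pderiv_sum _ fun j => (hu j).fun_mul (HasTemperateGrowth.pderiv (hu i) l j)]
    exact Finset.sum_congr rfl fun j _ => by
      rw [pderiv_mul (hu j) (HasTemperateGrowth.pderiv (hu i) l j)]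
  simp only [h1, mul_add, Finset.sum_add_distrib]
  rw [energyDensity, add_comm, add_assoc]
  congr 1
  · exact Finset.sum_congr rfl fun j _ => by split_ifs <;> simp
  · simp only [divergence, h2]
    simp only [Finset.mul_sum]
    rw [Finset.sum_comm, Finset.sum_comm (f := fun j i => pderiv l i (u j) g * pderiv l j (u i) g),
      ← Finset.sum_add_distrib]
    refine Finset.sum_congr rfl fun i _ => ?_
    rw [selfAdvection, Finset.mul_sum, ← Finset.sum_sub_distrib, ← Finset.sum_add_distrib]
    exact Finset.sum_congr rfl fun j _ => by ring

/-- Adjointness tested against the power `δ^(m+1)`, followed by the chain rule. -/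
theorem integral_divergence_pow (l : Fin N) (m : ℕ) :
    ∫ g, divergence l u g ^ (m + 2) ∂gauss N = (m + 1) *
      ∫ g, divergence l u g ^ m * (energyDensity l u g + divergence l (selfAdvection l u) g)
        ∂gauss N := by
  have hd := hasTemperateGrowth_divergence hu l
  have h1 := integral_divergence_mul hu l (hd.pow (m + 1))
  rw [← integral_const_mul]
  have h2 : ∀ g, divergence l u g ^ (m + 2) = divergence l u g * (divergence l u ^ (m + 1)) g := by
    intro g
    simp only [Pi.pow_apply]
    ring
  simp only [h2, h1]
  refine integral_congr_ae (Filter.Eventually.of_forall fun g => ?_)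
  have h4 : ∀ j, pderiv l j (divergence l u ^ (m + 1)) g =
      (m + 1) * divergence l u g ^ m * pderiv l j (divergence l u) g := by
    intro j
    have := congrFun (pderiv_pow hd (m + 1) l j) g
    simpa using! this
  simp only [h4, ← sum_mul_pderiv_divergence hu, Finset.mul_sum]
  exact Finset.sum_congr rfl fun j _ => by ring

end Divergence

/-! ### From the moment identity to a moment inequality -/

section MomentInequality

/-- A Young inequality by cases on `2c ≤ t`; the factor `1/2` allows the first term to be absorbed
later. -/
theorem pow_mul_le_half_pow_add {t c : ℝ} (ht : 0 ≤ t) (hc : 0 ≤ c) (q : ℕ) :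
    t ^ q * c ≤ t ^ (q + 1) / 2 + (2 * c) ^ (q + 1) := by
  rcases le_total (2 * c) t with h | h
  · have h1 : t ^ q * c ≤ t ^ q * (t / 2) := by gcongr; linarith
    have h2 : 0 ≤ (2 * c) ^ (q + 1) := by positivity
    calc t ^ q * c ≤ t ^ q * (t / 2) := h1
      _ = t ^ (q + 1) / 2 := by ring
      _ ≤ _ := by linarith
  · have h1 : t ^ q * c ≤ (2 * c) ^ q * (2 * c) := by gcongr; linarith
    have h2 : 0 ≤ t ^ (q + 1) / 2 := by positivity
    calc t ^ q * c ≤ (2 * c) ^ q * (2 * c) := h1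
      _ = (2 * c) ^ (q + 1) := by ring
      _ ≤ _ := by linarith

variable {N : ℕ} {u : Fin N → Disorder N → ℝ} (hu : ∀ j, (u j).HasTemperateGrowth)
include hu

theorem integral_divergence (l : Fin N) : ∫ g, divergence l u g ∂gauss N = 0 := by
  have := integral_divergence_mul hu l (Function.HasTemperateGrowth.const (1 : ℝ))
  simpa [pderiv_const] using this

/-- In the second moment the divergence of the self-advection has mean zero, so the energy alone
matters. -/
theorem nrm_one_divergence_le (l : Fin N) {B : ℝ} (hB : 0 ≤ B)
    (h : nrm 0 (energyDensity l u) ≤ B ^ 2) : nrm 1 (divergence l u) ≤ B := by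
  have hw := hasTemperateGrowth_selfAdvection hu l
  have hT := hasTemperateGrowth_energyDensity hu l
  refine le_of_pow_le_pow_left₀ (n := 2 ^ 1) (by norm_num) hB ?_
  rw [nrm_pow (hasTemperateGrowth_divergence hu l)]
  have h1 := integral_divergence_pow hu l 0
  simp only [pow_zero, one_mul, Nat.cast_zero, zero_add] at h1
  have h2 := nrm_pow hT 0
  simp only [pow_zero, pow_one] at h2
  simp only [pow_one, sq_abs]
  rw [h1, integral_add (integrable_stdGauss hT)
    (integrable_stdGauss (hasTemperateGrowth_divergence hw l)), integral_divergence hw, add_zero]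
  refine le_trans ?_ h
  rw [h2]
  exact integral_mono (integrable_stdGauss hT) (integrable_stdGauss hT).abs fun g => le_abs_self _

/-- The moment identity at even order, with the highest moment absorbed on the left by Young's
inequality. The exponent on the right is half of that on the left. -/
theorem nrm_divergence_le (l : Fin N) (p : ℕ) {B : ℝ} (hB : 0 ≤ B)
    (h : nrm (p + 1) (fun g => energyDensity l u g + divergence l (selfAdvection l u) g) ≤ B ^ 2) :
    nrm (p + 2) (divergence l u) ≤ 4 * 2 ^ (p + 2) * B := by
  have hV : (fun g => energyDensity l u g +
      divergence l (selfAdvection l u) g).HasTemperateGrowth :=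
    (hasTemperateGrowth_energyDensity hu l).fun_add
      (hasTemperateGrowth_divergence (hasTemperateGrowth_selfAdvection hu l) l)
  have hd := hasTemperateGrowth_divergence hu l
  set V := fun g => energyDensity l u g + divergence l (selfAdvection l u) g
  set D := divergence l u
  -- The target exponent is then `2q + 2`, so the moment identity applies with `m = 2q` and all
  -- powers of the divergence are even.
  obtain ⟨q, hq⟩ : ∃ q, 2 ^ (p + 1) = q + 1 :=
    ⟨2 ^ (p + 1) - 1, (Nat.sub_add_cancel Nat.one_le_two_pow).symm⟩
  have hq2 : 2 ^ (p + 2) = 2 * q + 2 := by rw [pow_succ, hq]; ring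
  have hqR : (4 * 2 ^ (p + 2) : ℝ) = 4 * (2 * q + 2) := by
    have : ((2 ^ (p + 2) : ℕ) : ℝ) = ((2 * q + 2 : ℕ) : ℝ) := by rw [hq2]
    push_cast at this
    rw [this]
  refine le_of_pow_le_pow_left₀ (n := 2 ^ (p + 2)) (by positivity) (by positivity) ?_
  rw [nrm_pow hd, hqR]
  have habs : ∀ g, |D g| ^ 2 ^ (p + 2) = D g ^ (2 * q + 2) := by
    intro g
    rw [hq2, show 2 * q + 2 = 2 * (q + 1) by ring, pow_mul, sq_abs, pow_mul]
  simp only [habs]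
  have h1 := integral_divergence_pow hu l (2 * q)
  have iD : Integrable (fun g => D g ^ (2 * q + 2)) (gauss N) :=
    integrable_stdGauss (hd.fun_pow (2 * q + 2))
  have iV : Integrable (fun g => |V g| ^ (q + 1)) (gauss N) := by
    have := (integrable_stdGauss (hV.fun_pow (q + 1))).abs
    simpa [abs_pow] using this
  have iDV : Integrable (fun g => D g ^ (2 * q) * V g) (gauss N) :=
    integrable_stdGauss ((hd.fun_pow (2 * q)).fun_mul hV)
  have h2 : ∫ g, D g ^ (2 * q + 2) ∂gauss N ≤
      ∫ g, (D g ^ (2 * q + 2) / 2 + (2 * (2 * q + 1)) ^ (q + 1) * |V g| ^ (q + 1)) ∂gauss N := by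
    rw [h1, ← integral_const_mul]
    refine integral_mono (iDV.const_mul _) ((iD.div_const 2).add (iV.const_mul _)) fun g => ?_
    -- Young with `t = D²` and the prefactor `2q + 1` of the moment identity put into `c`.
    have h3 := pow_mul_le_half_pow_add (sq_nonneg (D g))
      (c := (2 * q + 1) * |V g|) (by positivity) q
    rw [← mul_assoc 2 _ |V g|, mul_pow _ |V g|, ← pow_mul, ← pow_mul] at h3
    calc _ = D g ^ (2 * q) * ((2 * q + 1) * V g) := by push_cast; ring
      _ ≤ D g ^ (2 * q) * ((2 * q + 1) * |V g|) := by
        have : 0 ≤ D g ^ (2 * q) := by rw [pow_mul]; positivity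
        gcongr
        exact le_abs_self _
      _ ≤ _ := h3
  rw [integral_add (iD.div_const 2) (iV.const_mul _), integral_div, integral_const_mul] at h2
  have h4 : ∫ g, |V g| ^ (q + 1) ∂gauss N ≤ (B ^ 2) ^ (q + 1) := by
    have := nrm_pow hV (p + 1)
    rw [hq] at this
    rw [← this]
    exact pow_le_pow_left₀ (nrm_nonneg _ _) h _
  have h5 : ∫ g, D g ^ (2 * q + 2) ∂gauss N ≤
      2 * ((2 * (2 * q + 1)) ^ (q + 1) * (B ^ 2) ^ (q + 1)) := by
    have : (2 * (2 * q + 1) : ℝ) ^ (q + 1) * ∫ g, |V g| ^ (q + 1) ∂gauss N ≤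
      (2 * (2 * q + 1)) ^ (q + 1) * (B ^ 2) ^ (q + 1) := by gcongr
    linarith
  refine h5.trans ?_
  rw [hq2, show 2 * q + 2 = 2 * (q + 1) by ring, pow_mul, mul_pow _ B 2, mul_pow _ (B ^ 2) (q + 1),
    ← mul_assoc]
  gcongr
  -- The leading `2` comes from the absorption; it is hidden in the power, and the generous constant
  -- `4 (2q + 2)`, squared, dominates `4 (2q + 1)`.
  calc (2 : ℝ) * (2 * (2 * q + 1)) ^ (q + 1) ≤ 2 ^ (q + 1) * (2 * (2 * q + 1)) ^ (q + 1) := by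
        gcongr
        exact le_self_pow₀ (by norm_num) (by omega)
    _ = (4 * (2 * q + 1)) ^ (q + 1) := by rw [← mul_pow]; ring
    _ ≤ _ := by
        gcongr
        have : (0 : ℝ) ≤ q := by positivity
        nlinarith

end MomentInequality

/-! ### Iterated derivatives and the Leibniz rule -/

section IteratedDerivatives

variable {N : ℕ} {F G : Disorder N → ℝ}

/-- The iterated partial derivative along a list of pairs of sites. -/
def iterPderiv : List (Fin N × Fin N) → (Disorder N → ℝ) → Disorder N → ℝ
  | [], F => F
  | e :: L, F => iterPderiv L (pderiv e.1 e.2 F)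

theorem iterPderiv_append (A B : List (Fin N × Fin N)) (F : Disorder N → ℝ) :
    iterPderiv (A ++ B) F = iterPderiv B (iterPderiv A F) := by
  induction A generalizing F with
  | nil => rfl
  | cons e A ih => exact ih _

theorem HasTemperateGrowth.iterPderiv (hF : F.HasTemperateGrowth) (L : List (Fin N × Fin N)) :
    (iterPderiv L F).HasTemperateGrowth := by
  induction L generalizing F with
  | nil => exact hF
  | cons e L ih => exact ih (HasTemperateGrowth.pderiv hF _ _)

theorem iterPderiv_add (hF : F.HasTemperateGrowth) (hG : G.HasTemperateGrowth)
    (L : List (Fin N × Fin N)) :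
    iterPderiv L (fun g => F g + G g) = fun g => iterPderiv L F g + iterPderiv L G g := by
  induction L generalizing F G with
  | nil => rfl
  | cons e L ih =>
    simp only [iterPderiv]
    rw [pderiv_add hF hG, ih (HasTemperateGrowth.pderiv hF _ _) (HasTemperateGrowth.pderiv hG _ _)]

theorem iterPderiv_const_mul (hF : F.HasTemperateGrowth) (c : ℝ) (L : List (Fin N × Fin N)) :
    iterPderiv L (fun g => c * F g) = fun g => c * iterPderiv L F g := by
  induction L generalizing F with
  | nil => rfl
  | cons e L ih =>
    simp only [iterPderiv]
    rw [pderiv_const_mul hF, ih (HasTemperateGrowth.pderiv hF _ _)]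

theorem iterPderiv_sum {ι : Type*} (s : Finset ι) {F : ι → Disorder N → ℝ}
    (hF : ∀ a, (F a).HasTemperateGrowth) (L : List (Fin N × Fin N)) :
    iterPderiv L (fun g => ∑ a ∈ s, F a g) = fun g => ∑ a ∈ s, iterPderiv L (F a) g := by
  induction L generalizing F with
  | nil => rfl
  | cons e L ih =>
    simp only [iterPderiv]
    rw [pderiv_sum s hF, ih fun a => HasTemperateGrowth.pderiv (hF a) _ _]

/-- Leibniz gives one term for each of the `2^|L|` ways to distribute the derivatives. The lists
`A₀` and `B₀` record those already assigned, which makes the induction on `L` run. -/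
theorem nrm_iterPderiv_mul_le (hF : F.HasTemperateGrowth) (hG : G.HasTemperateGrowth) (p : ℕ)
    {M : ℝ} (L A₀ B₀ : List (Fin N × Fin N))
    (h : ∀ A B, A ⊆ L → B ⊆ L → A.length + B.length = L.length →
      nrm (p + 1) (iterPderiv (A₀ ++ A) F) * nrm (p + 1) (iterPderiv (B₀ ++ B) G) ≤ M) :
    nrm p (iterPderiv L (fun g => iterPderiv A₀ F g * iterPderiv B₀ G g)) ≤ 2 ^ L.length * M := by
  induction L generalizing A₀ B₀ with
  | nil =>
    have h1 := h [] [] (by simp) (by simp) rfl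
    simp only [List.append_nil] at h1
    simpa [iterPderiv] using (nrm_mul_le (HasTemperateGrowth.iterPderiv hF A₀)
      (HasTemperateGrowth.iterPderiv hG B₀) p).trans h1
  | cons e L ih =>
    have tF := HasTemperateGrowth.iterPderiv hF
    have tG := HasTemperateGrowth.iterPderiv hG
    have h1 := ih (A₀ ++ [e]) B₀ fun A B hA hB hAB => by
      rw [List.append_assoc]
      exact h _ _ (List.cons_subset_cons e hA) (List.subset_cons_of_subset e hB)
        (by simp; omega)
    have h2 := ih A₀ (B₀ ++ [e]) fun A B hA hB hAB => by
      rw [List.append_assoc]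
      exact h _ _ (List.subset_cons_of_subset e hA) (List.cons_subset_cons e hB)
        (by simp; omega)
    rw [iterPderiv, pderiv_mul (tF A₀) (tG B₀)]
    simp only [iterPderiv_append, iterPderiv] at h1 h2
    rw [iterPderiv_add ((HasTemperateGrowth.pderiv (tF A₀) _ _).fun_mul (tG B₀))
      ((tF A₀).fun_mul (HasTemperateGrowth.pderiv (tG B₀) _ _))]
    refine (nrm_add_le (HasTemperateGrowth.iterPderiv
      ((HasTemperateGrowth.pderiv (tF A₀) _ _).fun_mul (tG B₀)) L) p).trans
      ((add_le_add h1 h2).trans (le_of_eq ?_))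
    rw [List.length_cons, pow_succ]
    ring

/-- The sites that occur in a list of pairs. -/
def sites : List (Fin N × Fin N) → Finset (Fin N)
  | [] => ∅
  | e :: L => insert e.1 (insert e.2 (sites L))

theorem mem_sites {L : List (Fin N × Fin N)} {j : Fin N} :
    j ∈ sites L ↔ ∃ e ∈ L, j = e.1 ∨ j = e.2 := by
  induction L with
  | nil => simp [sites]
  | cons e L ih => simp [sites, ih, or_assoc]

theorem sites_mono {A L : List (Fin N × Fin N)} (h : A ⊆ L) : sites A ⊆ sites L := by
  intro j hj
  obtain ⟨e, he, hj⟩ := mem_sites.1 hj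
  exact mem_sites.2 ⟨e, h he, hj⟩

theorem card_sites_le (L : List (Fin N × Fin N)) : (sites L).card ≤ 2 * L.length := by
  induction L with
  | nil => simp [sites]
  | cons e L ih =>
    simp only [sites, List.length_cons]
    have h1 := Finset.card_insert_le e.1 (insert e.2 (sites L))
    have h2 := Finset.card_insert_le e.2 (sites L)
    omega

end IteratedDerivatives

/-! ### Bounds on derivatives, uniform over families -/

section Families

variable {I : Type} {N : I → ℕ} {F G : ∀ i, Disorder (N i) → ℝ}
  {w w₁ w₂ : ∀ i, List (Fin (N i) × Fin (N i)) → ℝ} {n : ℕ}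

/-- All derivatives of order at most `n` of the members of a family of functions of the disorder
are bounded in every `L^p` by the weight `w`, up to a constant that does not depend on the member. -/
def DerivBound (N : I → ℕ) (n : ℕ) (F : ∀ i, Disorder (N i) → ℝ)
    (w : ∀ i, List (Fin (N i) × Fin (N i)) → ℝ) : Prop :=
  (∀ i, (F i).HasTemperateGrowth) ∧
    ∀ p, ∃ C, 0 ≤ C ∧ ∀ i L, L.length ≤ n → nrm p (iterPderiv L (F i)) ≤ C * w i L

theorem DerivBound.mono (h : DerivBound N n F w₁) {K : ℝ} (hK : 0 ≤ K)
    (hw : ∀ i L, L.length ≤ n → w₁ i L ≤ K * w₂ i L) : DerivBound N n F w₂ := by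
  refine ⟨h.1, fun p => ?_⟩
  obtain ⟨C, hC, hb⟩ := h.2 p
  refine ⟨C * K, mul_nonneg hC hK, fun i L hL => (hb i L hL).trans ?_⟩
  rw [mul_assoc]
  exact mul_le_mul_of_nonneg_left (hw i L hL) hC

theorem DerivBound.of_le (h : DerivBound N n F w) {m : ℕ} (hm : m ≤ n) : DerivBound N m F w :=
  ⟨h.1, fun p => (h.2 p).imp fun _ hC => ⟨hC.1, fun i L hL => hC.2 i L (hL.trans hm)⟩⟩

theorem DerivBound.reindex (h : DerivBound N n F w) {J : Type} (f : J → I) :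
    DerivBound (fun j => N (f j)) n (fun j => F (f j)) (fun j => w (f j)) :=
  ⟨fun j => h.1 (f j), fun p => (h.2 p).imp fun _ hC => ⟨hC.1, fun j L hL => hC.2 (f j) L hL⟩⟩

theorem DerivBound.add (hF : DerivBound N n F w) (hG : DerivBound N n G w) :
    DerivBound N n (fun i g => F i g + G i g) w := by
  refine ⟨fun i => (hF.1 i).fun_add (hG.1 i), fun p => ?_⟩
  obtain ⟨C₁, h₁, b₁⟩ := hF.2 p
  obtain ⟨C₂, h₂, b₂⟩ := hG.2 p
  refine ⟨C₁ + C₂, add_nonneg h₁ h₂, fun i L hL => ?_⟩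
  rw [iterPderiv_add (hF.1 i) (hG.1 i), add_mul]
  exact (nrm_add_le (HasTemperateGrowth.iterPderiv (hF.1 i) L) p).trans
    (add_le_add (b₁ i L hL) (b₂ i L hL))

theorem DerivBound.const_mul (hF : DerivBound N n F w) {c r : I → ℝ} (hc : ∀ i, |c i| ≤ r i) :
    DerivBound N n (fun i g => c i * F i g) (fun i L => r i * w i L) := by
  refine ⟨fun i => (Function.HasTemperateGrowth.const _).fun_mul (hF.1 i), fun p => ?_⟩
  obtain ⟨C, hC, b⟩ := hF.2 p
  refine ⟨C, hC, fun i L hL => ?_⟩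
  rw [iterPderiv_const_mul (hF.1 i), nrm_const_mul, mul_left_comm]
  exact mul_le_mul (hc i) (b i L hL) (nrm_nonneg _ _) ((abs_nonneg _).trans (hc i))

theorem DerivBound.sum {J : I → Type} [∀ i, Fintype (J i)] {F : ∀ i, J i → Disorder (N i) → ℝ}
    {w₁ : ∀ x : (i : I) × J i, List (Fin (N x.1) × Fin (N x.1)) → ℝ}
    (hF : DerivBound (fun x : (i : I) × J i => N x.1) n (fun x => F x.1 x.2) w₁)
    {K : ℝ} (hK : 0 ≤ K) (hw : ∀ i L, L.length ≤ n → ∑ j, w₁ ⟨i, j⟩ L ≤ K * w i L) :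
    DerivBound N n (fun i g => ∑ j, F i j g) w := by
  refine ⟨fun i => Function.HasTemperateGrowth.sum fun j _ => hF.1 ⟨i, j⟩, fun p => ?_⟩
  obtain ⟨C, hC, b⟩ := hF.2 p
  refine ⟨C * K, mul_nonneg hC hK, fun i L hL => ?_⟩
  rw [iterPderiv_sum _ fun j => hF.1 ⟨i, j⟩]
  calc _ ≤ ∑ j, nrm p (iterPderiv L (F i j)) :=
        nrm_sum_le _ (fun j => HasTemperateGrowth.iterPderiv (hF.1 ⟨i, j⟩) L) p
    _ ≤ ∑ j, C * w₁ ⟨i, j⟩ L := Finset.sum_le_sum fun j _ => b ⟨i, j⟩ L hL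
    _ = C * ∑ j, w₁ ⟨i, j⟩ L := by rw [Finset.mul_sum]
    _ ≤ C * (K * w i L) := mul_le_mul_of_nonneg_left (hw i L hL) hC
    _ = _ := by ring

theorem DerivBound.mul (hF : DerivBound N n F w₁) (hG : DerivBound N n G w₂)
    (hw : ∀ i (A B L : List (Fin (N i) × Fin (N i))), L.length ≤ n → A ⊆ L → B ⊆ L →
      A.length + B.length = L.length → w₁ i A * w₂ i B ≤ w i L) :
    DerivBound N n (fun i g => F i g * G i g) w := by
  refine ⟨fun i => (hF.1 i).fun_mul (hG.1 i), fun p => ?_⟩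
  obtain ⟨C₁, h₁, b₁⟩ := hF.2 (p + 1)
  obtain ⟨C₂, h₂, b₂⟩ := hG.2 (p + 1)
  refine ⟨2 ^ n * (C₁ * C₂), by positivity, fun i L hL => ?_⟩
  have h := nrm_iterPderiv_mul_le (hF.1 i) (hG.1 i) p (M := C₁ * C₂ * w i L) L [] []
    fun A B hA hB hAB => by
      have a₁ := b₁ i A (by omega)
      have a₂ := b₂ i B (by omega)
      calc _ ≤ (C₁ * w₁ i A) * (C₂ * w₂ i B) :=
            mul_le_mul a₁ a₂ (nrm_nonneg _ _) ((nrm_nonneg _ _).trans a₁)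
        _ = C₁ * C₂ * (w₁ i A * w₂ i B) := by ring
        _ ≤ _ := mul_le_mul_of_nonneg_left (hw i A B L hL hA hB hAB) (mul_nonneg h₁ h₂)
  -- The weight is not assumed nonnegative; its sign comes from the bound on a norm just obtained.
  have h0 : 0 ≤ C₁ * C₂ * w i L := by
    have := (nrm_nonneg _ _).trans h
    exact nonneg_of_mul_nonneg_right this (by positivity)
  refine h.trans ?_
  rw [mul_assoc (2 ^ n)]
  exact mul_le_mul_of_nonneg_right (pow_le_pow_right₀ one_le_two hL) h0

/-- First derivatives form a new family, indexed also by the pair of sites, so uniformity in the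
direction is built in. `DerivBound.succ` is the converse and drives inductions on the order. -/
theorem DerivBound.pderiv (hF : DerivBound N (n + 1) F w) :
    DerivBound (fun x : (i : I) × (Fin (N i) × Fin (N i)) => N x.1) n
      (fun x => pderiv x.2.1 x.2.2 (F x.1)) (fun x L => w x.1 (x.2 :: L)) :=
  ⟨fun x => HasTemperateGrowth.pderiv (hF.1 x.1) _ _, fun p => (hF.2 p).imp fun _ hC =>
    ⟨hC.1, fun x L hL => hC.2 x.1 (x.2 :: L) (by simpa using hL)⟩⟩

theorem DerivBound.succ (hw : ∀ i L, 0 ≤ w i L) (h0 : DerivBound N 0 F w)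
    (hF : DerivBound (fun x : (i : I) × (Fin (N i) × Fin (N i)) => N x.1) n
      (fun x => TAP.pderiv x.2.1 x.2.2 (F x.1)) (fun x L => w x.1 (x.2 :: L))) :
    DerivBound N (n + 1) F w := by
  refine ⟨h0.1, fun p => ?_⟩
  obtain ⟨C₁, h₁, b₁⟩ := h0.2 p
  obtain ⟨C₂, h₂, b₂⟩ := hF.2 p
  refine ⟨max C₁ C₂, le_max_of_le_left h₁, fun i L hL => ?_⟩
  cases L with
  | nil =>
    exact (b₁ i [] (by simp)).trans (mul_le_mul_of_nonneg_right (le_max_left _ _) (hw _ _))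
  | cons e L =>
    exact (b₂ ⟨i, e⟩ L (by simpa using hL)).trans
      (mul_le_mul_of_nonneg_right (le_max_right _ _) (hw _ _))

end Families

/-! ### Site weights and their sums -/

section SiteWeights

/-- The natural size `1 / √N` of the normalized couplings. -/
def scale (N : ℕ) : ℝ := 1 / √(N : ℝ)

theorem scale_nonneg (N : ℕ) : 0 ≤ scale N := by unfold scale; positivity

theorem scale_le_one (N : ℕ) : scale N ≤ 1 := by
  unfold scale
  rcases Nat.eq_zero_or_pos N with rfl | h
  · simp
  · rw [div_le_one (by positivity)]
    exact Real.one_le_sqrt.2 (by exact_mod_cast h)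

theorem scale_sq (N : ℕ) : scale N ^ 2 = 1 / N := by
  simp [scale]

theorem natCast_mul_scale_sq {N : ℕ} (hN : 0 < N) : (N : ℝ) * scale N ^ 2 = 1 := by
  rw [scale_sq]
  field_simp

variable {N : ℕ}

/-- The weight of a site relative to a set of distinguished sites. -/
def siteWeight (S : Finset (Fin N)) (j : Fin N) : ℝ := if j ∈ S then 1 else scale N

theorem siteWeight_nonneg (S : Finset (Fin N)) (j : Fin N) : 0 ≤ siteWeight S j := by
  unfold siteWeight
  split_ifs
  · exact zero_le_one
  · exact scale_nonneg N

theorem siteWeight_le_one (S : Finset (Fin N)) (j : Fin N) : siteWeight S j ≤ 1 := by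
  unfold siteWeight
  split_ifs
  · exact le_rfl
  · exact scale_le_one N

theorem scale_le_siteWeight (S : Finset (Fin N)) (j : Fin N) : scale N ≤ siteWeight S j := by
  unfold siteWeight
  split_ifs
  · exact scale_le_one N
  · exact le_rfl

theorem siteWeight_of_mem {S : Finset (Fin N)} {j : Fin N} (h : j ∈ S) : siteWeight S j = 1 :=
  if_pos h

theorem siteWeight_mono {S T : Finset (Fin N)} (h : S ⊆ T) (j : Fin N) :
    siteWeight S j ≤ siteWeight T j := by
  by_cases hj : j ∈ S
  · rw [siteWeight_of_mem hj, siteWeight_of_mem (h hj)]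
  · rw [siteWeight, if_neg hj]
    exact scale_le_siteWeight T j

/-- A new distinguished site changes the weight at that site only, so it costs `O(1)` in sums over
sites. -/
theorem siteWeight_insert_le (a : Fin N) (S : Finset (Fin N)) (j : Fin N) :
    siteWeight (insert a S) j ≤ siteWeight S j + if j = a then 1 else 0 := by
  by_cases h : j = a
  · rw [if_pos h]
    linarith [siteWeight_le_one (insert a S) j, siteWeight_nonneg S j]
  · simp [siteWeight, h]

theorem siteWeight_le_add (S : Finset (Fin N)) (j : Fin N) :
    siteWeight S j ≤ (if j ∈ S then 1 else 0) + scale N := by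
  unfold siteWeight
  split_ifs
  · linarith [scale_nonneg N]
  · simp

/-- Each distinguished site contributes at most `1`, and the `N` ordinary ones together `N * scale N
^ 2 = 1`. The following sums rest on the same count. -/
theorem scale_mul_sum_siteWeight_le (hN : 0 < N) (S : Finset (Fin N)) :
    scale N * ∑ j, siteWeight S j ≤ S.card + 1 := by
  have h1 : ∑ j, siteWeight S j ≤ S.card + N * scale N := by
    calc ∑ j, siteWeight S j ≤ ∑ j, ((if j ∈ S then (1 : ℝ) else 0) + scale N) :=
          Finset.sum_le_sum fun j _ => siteWeight_le_add S j
      _ = _ := by simp [Finset.sum_add_distrib]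
  have h2 := natCast_mul_scale_sq hN
  have h3 : scale N * S.card ≤ 1 * S.card := by
    have := scale_le_one N
    gcongr
  calc scale N * ∑ j, siteWeight S j ≤ scale N * (S.card + N * scale N) :=
        mul_le_mul_of_nonneg_left h1 (scale_nonneg N)
    _ = scale N * S.card + N * scale N ^ 2 := by ring
    _ ≤ _ := by linarith

theorem sum_siteWeight_mul_self_le (hN : 0 < N) (S : Finset (Fin N)) :
    ∑ j, siteWeight S j * siteWeight S j ≤ S.card + 1 := by
  calc ∑ j, siteWeight S j * siteWeight S j
      ≤ ∑ j, ((if j ∈ S then (1 : ℝ) else 0) + scale N ^ 2) := by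
        refine Finset.sum_le_sum fun j _ => ?_
        unfold siteWeight
        split_ifs
        · nlinarith [scale_nonneg N]
        · nlinarith
    _ = S.card + N * scale N ^ 2 := by simp [Finset.sum_add_distrib]
    _ = _ := by rw [natCast_mul_scale_sq hN]

/-- The sum over `j` in a self-advection: the case `i = j` gives a single `scale N`, which the
weight at `i` dominates. -/
theorem scale_mul_sum_siteWeight_insert_le (hN : 0 < N) (S T : Finset (Fin N)) (hST : S ⊆ T)
    (i : Fin N) :
    scale N * ∑ j, siteWeight S j * siteWeight (insert j T) i ≤
      (T.card + 2) * siteWeight T i := by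
  have h1 : ∀ j, siteWeight S j * siteWeight (insert j T) i ≤
      siteWeight T j * siteWeight T i + if i = j then 1 else 0 := by
    intro j
    calc siteWeight S j * siteWeight (insert j T) i
        ≤ siteWeight S j * (siteWeight T i + if i = j then 1 else 0) :=
          mul_le_mul_of_nonneg_left (siteWeight_insert_le j T i) (siteWeight_nonneg _ _)
      _ = siteWeight S j * siteWeight T i + siteWeight S j * if i = j then 1 else 0 := by ring
      _ ≤ _ := by
        refine add_le_add (mul_le_mul_of_nonneg_right (siteWeight_mono hST j)
          (siteWeight_nonneg _ _)) ?_
        refine mul_le_of_le_one_left ?_ (siteWeight_le_one _ _)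
        split_ifs <;> norm_num
  calc scale N * ∑ j, siteWeight S j * siteWeight (insert j T) i
      ≤ scale N * ∑ j, (siteWeight T j * siteWeight T i + if i = j then 1 else 0) :=
        mul_le_mul_of_nonneg_left (Finset.sum_le_sum fun j _ => h1 j) (scale_nonneg N)
    _ = (scale N * ∑ j, siteWeight T j) * siteWeight T i + scale N := by
        rw [Finset.sum_add_distrib, ← Finset.sum_mul]
        simp
        ring
    _ ≤ (T.card + 1) * siteWeight T i + siteWeight T i :=
        add_le_add (mul_le_mul_of_nonneg_right (scale_mul_sum_siteWeight_le hN T)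
          (siteWeight_nonneg _ _)) (scale_le_siteWeight _ _)
    _ = _ := by ring

/-- The double sum in the energy. The diagonal has `N` terms of order one, compensated by the
prefactor `1 / N`; off it, the previous sums apply one after the other. -/
theorem scale_sq_mul_sum_sum_siteWeight_le (hN : 0 < N) (T : Finset (Fin N)) :
    scale N ^ 2 * ∑ j, ∑ i, siteWeight (insert i T) j * siteWeight (insert j T) i ≤
      (T.card + 2) * (T.card + 2) := by
  have h1 : ∀ j i, siteWeight (insert i T) j * siteWeight (insert j T) i ≤
      siteWeight T j * siteWeight (insert j T) i + if i = j then 1 else 0 := by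
    intro j i
    calc siteWeight (insert i T) j * siteWeight (insert j T) i
        ≤ (siteWeight T j + if j = i then 1 else 0) * siteWeight (insert j T) i :=
          mul_le_mul_of_nonneg_right (siteWeight_insert_le i T j) (siteWeight_nonneg _ _)
      _ = siteWeight T j * siteWeight (insert j T) i +
          (if j = i then 1 else 0) * siteWeight (insert j T) i := by ring
      _ ≤ _ := by
        gcongr
        by_cases h : j = i
        · subst h
          simpa using siteWeight_le_one _ _
        · simp [h, Ne.symm h]
  have hs := scale_nonneg N
  have h2 : ∑ j, ∑ i, siteWeight (insert i T) j * siteWeight (insert j T) i ≤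
      (∑ i, ∑ j, siteWeight T j * siteWeight (insert j T) i) + N := by
    calc _ ≤ ∑ j, ∑ i, (siteWeight T j * siteWeight (insert j T) i + if i = j then 1 else 0) :=
          Finset.sum_le_sum fun j _ => Finset.sum_le_sum fun i _ => h1 j i
      _ = _ := by
          simp only [Finset.sum_add_distrib]
          rw [Finset.sum_comm]
          simp
  have h3 : scale N * ∑ i, ∑ j, siteWeight T j * siteWeight (insert j T) i ≤
      (T.card + 2) * ∑ i, siteWeight T i := by
    rw [Finset.mul_sum, Finset.mul_sum]
    exact Finset.sum_le_sum fun i _ =>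
      scale_mul_sum_siteWeight_insert_le hN T T (Finset.Subset.refl _) i
  calc _ ≤ scale N ^ 2 * ((∑ i, ∑ j, siteWeight T j * siteWeight (insert j T) i) + N) :=
        mul_le_mul_of_nonneg_left h2 (by positivity)
    _ = scale N * (scale N * ∑ i, ∑ j, siteWeight T j * siteWeight (insert j T) i) +
        N * scale N ^ 2 := by ring
    _ ≤ scale N * ((T.card + 2) * ∑ i, siteWeight T i) + 1 := by
        rw [natCast_mul_scale_sq hN]
        gcongr
    _ = (T.card + 2) * (scale N * ∑ i, siteWeight T i) + 1 := by ring
    _ ≤ (T.card + 2) * (T.card + 1) + 1 := by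
        gcongr
        exact scale_mul_sum_siteWeight_le hN T
    _ ≤ _ := by nlinarith [(Nat.cast_nonneg T.card : (0 : ℝ) ≤ T.card)]

end SiteWeights

/-! ### Localized vector fields and their divergences -/

section LocalizedBounds

variable {I : Type} {N : I → ℕ} {n : ℕ} {t : I → ℝ} {S : ∀ i, Finset (Fin (N i))}
  {u : ∀ i, Fin (N i) → Disorder (N i) → ℝ}

/-- A family of vector fields of size `t`, smaller by the factor `scale N` at the sites that are
neither distinguished nor touched by a derivative. Every derivative gains a factor `scale N`. -/
def LocalizedBound (N : I → ℕ) (n : ℕ) (t : I → ℝ) (S : ∀ i, Finset (Fin (N i)))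
    (u : ∀ i, Fin (N i) → Disorder (N i) → ℝ) : Prop :=
  DerivBound (fun x : (i : I) × Fin (N i) => N x.1) n (fun x => u x.1 x.2)
    (fun x L => t x.1 * scale (N x.1) ^ L.length * siteWeight (S x.1 ∪ sites L) x.2)

/-- A family of functions of size `t`, every derivative of which gains a factor `scale N`. -/
def UniformBound (N : I → ℕ) (n : ℕ) (t : I → ℝ) (F : ∀ i, Disorder (N i) → ℝ) : Prop :=
  DerivBound N n F (fun i L => t i * scale (N i) ^ L.length)

theorem LocalizedBound.hasTemperateGrowth (h : LocalizedBound N n t S u) (i : I) (j : Fin (N i)) :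
    (u i j).HasTemperateGrowth := h.1 ⟨i, j⟩

theorem LocalizedBound.reindex (h : LocalizedBound N n t S u) {J : Type} (f : J → I) :
    LocalizedBound (fun j => N (f j)) n (fun j => t (f j)) (fun j => S (f j))
      (fun j => u (f j)) :=
  DerivBound.reindex h (fun x : (j : J) × Fin (N (f j)) => (⟨f x.1, x.2⟩ : (i : I) × Fin (N i)))

theorem LocalizedBound.mono_set (ht : ∀ i, 0 ≤ t i) (h : LocalizedBound N n t S u)
    {T : ∀ i, Finset (Fin (N i))} (hST : ∀ i, S i ⊆ T i) : LocalizedBound N n t T u := by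
  refine DerivBound.mono h zero_le_one fun x L _ => ?_
  rw [one_mul]
  exact mul_le_mul_of_nonneg_left
    (siteWeight_mono (Finset.union_subset_union_left (hST x.1)) _)
    (mul_nonneg (ht _) (pow_nonneg (scale_nonneg _) _))

theorem LocalizedBound.uniform (ht : ∀ i, 0 ≤ t i) (h : LocalizedBound N n t S u) :
    UniformBound (fun x : (i : I) × Fin (N i) => N x.1) n (fun x => t x.1) (fun x => u x.1 x.2) :=
  DerivBound.mono h zero_le_one fun x L _ => by
    rw [one_mul]
    exact mul_le_of_le_one_right (mul_nonneg (ht _) (pow_nonneg (scale_nonneg _) _))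
      (siteWeight_le_one _ _)

theorem union_sites_cons {M : ℕ} (T : Finset (Fin M)) (e : Fin M × Fin M)
    (L : List (Fin M × Fin M)) : T ∪ sites (e :: L) = T ∪ {e.1, e.2} ∪ sites L := by
  ext j
  simp only [sites, Finset.mem_union, Finset.mem_insert, Finset.mem_singleton]
  tauto

theorem LocalizedBound.pderiv (h : LocalizedBound N (n + 1) t S u) :
    LocalizedBound (fun x : (i : I) × (Fin (N i) × Fin (N i)) => N x.1) n
      (fun x => t x.1 * scale (N x.1)) (fun x => S x.1 ∪ {x.2.1, x.2.2})
      (fun x j => pderiv x.2.1 x.2.2 (u x.1 j)) := by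
  have h1 := (DerivBound.pderiv h).reindex
    (fun y : (x : (i : I) × (Fin (N i) × Fin (N i))) × Fin (N x.1) =>
      (⟨⟨y.1.1, y.2⟩, y.1.2⟩ : (z : (i : I) × Fin (N i)) × (Fin (N z.1) × Fin (N z.1))))
  refine DerivBound.mono h1 zero_le_one fun y L _ => ?_
  rw [one_mul, union_sites_cons, List.length_cons, pow_succ]
  exact le_of_eq (by ring)

/-- The derivative `∂_{lj}` gains `scale N`, which pays for the sum over `j`. So sizes multiply, and
only `l` joins the distinguished sites. One order of derivatives is lost, hence bounds of all orders
are assumed. -/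
theorem LocalizedBound.selfAdvection (hN : ∀ i, 0 < N i) (ht : ∀ i, 0 ≤ t i) {K : ℕ}
    (hS : ∀ i, (S i).card ≤ K) (h : ∀ n, LocalizedBound N n t S u) (l : ∀ i, Fin (N i)) (n : ℕ) :
    LocalizedBound N n (fun i => t i ^ 2) (fun i => insert (l i) (S i))
      (fun i => selfAdvection (l i) (u i)) := by
  let Z := (y : (i : I) × Fin (N i)) × Fin (N y.1)
  have h1 := DerivBound.reindex (h n) (fun z : Z => (⟨z.1.1, z.2⟩ : (i : I) × Fin (N i)))
  have h2 := (DerivBound.pderiv (h (n + 1))).reindex (fun z : Z =>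
    (⟨z.1, (l z.1.1, z.2)⟩ : (y : (i : I) × Fin (N i)) × (Fin (N y.1) × Fin (N y.1))))
  have h3 := DerivBound.mul (w := fun z L => t z.1.1 ^ 2 * scale (N z.1.1) ^ (L.length + 1) *
    (siteWeight (S z.1.1 ∪ sites L) z.2 *
      siteWeight (insert z.2 (insert (l z.1.1) (S z.1.1) ∪ sites L)) z.1.2)) h1 h2 ?_
  · refine DerivBound.sum (J := fun y : (i : I) × Fin (N i) => Fin (N y.1))
      (F := fun y j g => u y.1 j g * TAP.pderiv (l y.1) j (u y.1 y.2) g) h3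
      (K := K + 2 * n + 3) (by positivity) fun y L hL => ?_
    dsimp only
    rw [← Finset.mul_sum]
    set T := insert (l y.1) (S y.1) ∪ sites L
    have h4 := scale_mul_sum_siteWeight_insert_le (hN y.1) (S y.1 ∪ sites L) T
      (Finset.union_subset_union_left (Finset.subset_insert _ _)) y.2
    have h5 : (T.card : ℝ) ≤ K + 1 + 2 * n := by
      have a1 : T.card ≤ _ := Finset.card_union_le (insert (l y.1) (S y.1)) (sites L)
      have a2 := Finset.card_insert_le (l y.1) (S y.1)
      have a3 := card_sites_le L
      have a4 := hS y.1
      have : T.card ≤ K + 1 + 2 * n := by omega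
      exact_mod_cast this
    calc _ = t y.1 ^ 2 * scale (N y.1) ^ L.length * (scale (N y.1) *
          ∑ j, siteWeight (S y.1 ∪ sites L) j * siteWeight (insert j T) y.2) := by
          rw [pow_succ]; ring
      _ ≤ t y.1 ^ 2 * scale (N y.1) ^ L.length * ((K + 2 * n + 3) * siteWeight T y.2) := by
          refine mul_le_mul_of_nonneg_left (h4.trans ?_)
            (mul_nonneg (sq_nonneg _) (pow_nonneg (scale_nonneg _) _))
          exact mul_le_mul_of_nonneg_right (by linarith) (siteWeight_nonneg _ _)
      _ = _ := by ring
  · intro z A B L _ hA hB hAB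
    have hs := scale_nonneg (N z.1.1)
    have ht' := ht z.1.1
    have e1 : scale (N z.1.1) ^ (L.length + 1) =
        scale (N z.1.1) ^ A.length * scale (N z.1.1) ^ (B.length + 1) := by
      rw [← pow_add, ← hAB, add_assoc]
    have a1 : siteWeight (S z.1.1 ∪ sites A) z.2 ≤ siteWeight (S z.1.1 ∪ sites L) z.2 :=
      siteWeight_mono (Finset.union_subset_union_right (sites_mono hA)) _
    have a2 : siteWeight (S z.1.1 ∪ sites ((l z.1.1, z.2) :: B)) z.1.2 ≤
        siteWeight (insert z.2 (insert (l z.1.1) (S z.1.1) ∪ sites L)) z.1.2 := by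
      refine siteWeight_mono (fun j hj => ?_) _
      simp only [sites, Finset.mem_union, Finset.mem_insert] at hj ⊢
      have := @sites_mono _ _ _ hB j
      tauto
    calc _ = t z.1.1 ^ 2 * scale (N z.1.1) ^ (L.length + 1) *
          (siteWeight (S z.1.1 ∪ sites A) z.2 *
            siteWeight (S z.1.1 ∪ sites ((l z.1.1, z.2) :: B)) z.1.2) := by
          rw [e1, List.length_cons]; ring
      _ ≤ _ := by
          refine mul_le_mul_of_nonneg_left (mul_le_mul a1 a2 (siteWeight_nonneg _ _)
            (siteWeight_nonneg _ _)) (by positivity)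

/-- Hölder reduces both parts of the energy to sums of products of weights, which are bounded
independently of `N`. -/
theorem LocalizedBound.nrm_energyDensity_le (hN : ∀ i, 0 < N i) (ht : ∀ i, 0 ≤ t i) {K : ℕ}
    (hS : ∀ i, (S i).card ≤ K) (h : ∀ n, LocalizedBound N n t S u) (l : ∀ i, Fin (N i)) (p : ℕ) :
    ∃ C, 0 ≤ C ∧ ∀ i, nrm p (energyDensity (l i) (u i)) ≤ C * t i ^ 2 := by
  obtain ⟨C, hC, b⟩ := (h 1).2 (p + 1)
  refine ⟨C ^ 2 * (K + 1) + C ^ 2 * ((K + 3) * (K + 3)), by positivity, fun i => ?_⟩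
  have hu : ∀ j, (u i j).HasTemperateGrowth := (h 0).hasTemperateGrowth i
  have hdu : ∀ j k, (TAP.pderiv (l i) k (u i j)).HasTemperateGrowth :=
    fun j k => HasTemperateGrowth.pderiv (hu j) _ _
  have hs := scale_nonneg (N i)
  have ht' := ht i
  have b0 : ∀ j, nrm (p + 1) (u i j) ≤ C * t i * siteWeight (S i) j := by
    intro j
    have := b ⟨i, j⟩ [] (by simp)
    simpa [iterPderiv, sites, mul_assoc] using this
  set T := insert (l i) (S i)
  have hT : (T.card : ℝ) ≤ K + 1 := by
    have a2 : T.card ≤ (S i).card + 1 := Finset.card_insert_le _ _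
    have a4 := hS i
    have : T.card ≤ K + 1 := by omega
    exact_mod_cast this
  have b1 : ∀ j k, nrm (p + 1) (TAP.pderiv (l i) k (u i j)) ≤
      C * t i * scale (N i) * siteWeight (insert k T) j := by
    intro j k
    have := b ⟨i, j⟩ [(l i, k)] (by simp)
    have e : S i ∪ sites [(l i, k)] = insert k T := by
      ext x
      simp only [sites, Finset.mem_union, Finset.mem_insert, T]
      simp; tauto
    simpa [iterPderiv, mul_assoc, e] using this
  have m1 : ∀ j, (fun g => if l i ≠ j then u i j g * u i j g else 0).HasTemperateGrowth := by
    intro j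
    split_ifs
    · exact (hu j).mul (hu j)
    · exact Function.HasTemperateGrowth.const _
  have m2 : ∀ j k, (fun g => TAP.pderiv (l i) k (u i j) g *
      TAP.pderiv (l i) j (u i k) g).HasTemperateGrowth := fun j k => (hdu j k).mul (hdu k j)
  have c1 : nrm p (fun g => ∑ j, if l i ≠ j then u i j g * u i j g else 0) ≤
      C ^ 2 * (K + 1) * t i ^ 2 := by
    calc _ ≤ ∑ j, nrm p (fun g => if l i ≠ j then u i j g * u i j g else 0) :=
          nrm_sum_le _ m1 p
      _ ≤ ∑ j, C ^ 2 * t i ^ 2 * (siteWeight (S i) j * siteWeight (S i) j) := by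
          refine Finset.sum_le_sum fun j _ => ?_
          have hw := siteWeight_nonneg (S i) j
          split_ifs
          · calc _ ≤ (C * t i * siteWeight (S i) j) * (C * t i * siteWeight (S i) j) :=
                  (nrm_mul_le (hu j) (hu j) p).trans
                    (mul_le_mul (b0 j) (b0 j) (nrm_nonneg _ _) (by positivity))
              _ = _ := by ring
          · rw [nrm_const, abs_zero]
            positivity
      _ = C ^ 2 * t i ^ 2 * ∑ j, siteWeight (S i) j * siteWeight (S i) j := by
          rw [Finset.mul_sum]
      _ ≤ C ^ 2 * t i ^ 2 * (K + 1) := by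
          refine mul_le_mul_of_nonneg_left ((sum_siteWeight_mul_self_le (hN i) (S i)).trans ?_)
            (by positivity)
          have := hS i
          gcongr
      _ = _ := by ring
  have c2 : nrm p (fun g => ∑ j, ∑ k, TAP.pderiv (l i) k (u i j) g *
      TAP.pderiv (l i) j (u i k) g) ≤ C ^ 2 * ((K + 3) * (K + 3)) * t i ^ 2 := by
    calc _ ≤ ∑ j, ∑ k, nrm p (fun g => TAP.pderiv (l i) k (u i j) g *
            TAP.pderiv (l i) j (u i k) g) :=
          (nrm_sum_le _ (fun j => Function.HasTemperateGrowth.sum fun k _ => m2 j k) p).trans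
            (Finset.sum_le_sum fun j _ => nrm_sum_le _ (m2 j) p)
      _ ≤ ∑ j, ∑ k, C ^ 2 * t i ^ 2 * scale (N i) ^ 2 *
            (siteWeight (insert k T) j * siteWeight (insert j T) k) := by
          refine Finset.sum_le_sum fun j _ => Finset.sum_le_sum fun k _ => ?_
          have hw := siteWeight_nonneg (insert k T) j
          calc _ ≤ (C * t i * scale (N i) * siteWeight (insert k T) j) *
                (C * t i * scale (N i) * siteWeight (insert j T) k) :=
                (nrm_mul_le (hdu j k) (hdu k j) p).trans
                    (mul_le_mul (b1 j k) (b1 k j) (nrm_nonneg _ _) (by positivity))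
            _ = _ := by ring
      _ = C ^ 2 * t i ^ 2 * (scale (N i) ^ 2 *
            ∑ j, ∑ k, siteWeight (insert k T) j * siteWeight (insert j T) k) := by
          simp only [← Finset.mul_sum]
          ring
      _ ≤ C ^ 2 * t i ^ 2 * ((K + 3) * (K + 3)) := by
          refine mul_le_mul_of_nonneg_left
            ((scale_sq_mul_sum_sum_siteWeight_le (hN i) T).trans ?_) (by positivity)
          have : (T.card : ℝ) + 2 ≤ K + 3 := by linarith
          gcongr
      _ = _ := by ring
  rw [add_mul]
  exact (nrm_add_le (Function.HasTemperateGrowth.sum fun j _ => m1 j) p).trans (add_le_add c1 c2)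

/-- The divergence of a localized vector field has the size of the field in every `L^p`. -/
theorem LocalizedBound.nrm_divergence_le (p : ℕ) {I : Type} {N : I → ℕ} (hN : ∀ i, 0 < N i)
    {t : I → ℝ} (ht : ∀ i, 0 ≤ t i) {S : ∀ i, Finset (Fin (N i))} {K : ℕ}
    (hS : ∀ i, (S i).card ≤ K) {u : ∀ i, Fin (N i) → Disorder (N i) → ℝ}
    (h : ∀ n, LocalizedBound N n t S u) (l : ∀ i, Fin (N i)) :
    ∃ C, 0 ≤ C ∧ ∀ i, nrm (p + 1) (divergence (l i) (u i)) ≤ C * t i := by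
  -- The family must vary: the step applies the hypothesis to the self-advection, of size `t²` and
  -- with one more distinguished site.
  induction p generalizing I K with
  | zero =>
    obtain ⟨C, hC, b⟩ := LocalizedBound.nrm_energyDensity_le hN ht hS h l 0
    -- `C + 1` is used since `C ≤ (C + 1)²`, which avoids a square root.
    refine ⟨C + 1, by positivity, fun i => nrm_one_divergence_le ((h 0).hasTemperateGrowth i) _
      (mul_nonneg (by positivity) (ht i)) ((b i).trans ?_)⟩
    rw [mul_pow]
    exact mul_le_mul_of_nonneg_right (by nlinarith) (sq_nonneg _)
  | succ p ih =>
    obtain ⟨C₁, h₁, b₁⟩ := LocalizedBound.nrm_energyDensity_le hN ht hS h l (p + 1)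
    obtain ⟨C₂, h₂, b₂⟩ := ih hN (fun i => sq_nonneg (t i)) (K := K + 1)
      (fun i => (Finset.card_insert_le _ _).trans (Nat.add_le_add_right (hS i) 1))
      (LocalizedBound.selfAdvection hN ht hS h l) l
    refine ⟨4 * 2 ^ (p + 2) * (C₁ + C₂ + 1), by positivity, fun i => ?_⟩
    have hu := (h 0).hasTemperateGrowth i
    rw [mul_assoc]
    refine TAP.nrm_divergence_le hu _ p (mul_nonneg (by positivity) (ht i)) ?_
    refine (nrm_add_le (hasTemperateGrowth_energyDensity hu _) (p + 1)).trans
      ((add_le_add (b₁ i) (b₂ i)).trans ?_)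
    rw [← add_mul, mul_pow]
    exact mul_le_mul_of_nonneg_right (by nlinarith) (sq_nonneg _)

/-- Differentiating gives the divergence of the differentiated field, smaller by `scale N`, and
commutator terms. The latter lack this gain but occur only if `l` is an endpoint of the derivative,
where the site weight is `1`. The distinguished sites of `u` are forgotten, since the divergence is
bounded uniformly in `l`. -/
theorem LocalizedBound.scale_mul_divergence (n : ℕ) {I : Type} {N : I → ℕ} (hN : ∀ i, 0 < N i)
    {t : I → ℝ} (ht : ∀ i, 0 ≤ t i) {S : ∀ i, Finset (Fin (N i))} {K : ℕ}
    (hS : ∀ i, (S i).card ≤ K) {u : ∀ i, Fin (N i) → Disorder (N i) → ℝ}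
    (h : ∀ n, LocalizedBound N n t S u) :
    LocalizedBound N n t (fun _ => ∅) (fun i l g => scale (N i) * divergence l (u i) g) := by
  have tg : ∀ (i : I) (l : Fin (N i)), (divergence l (u i)).HasTemperateGrowth := fun i l =>
    hasTemperateGrowth_divergence ((h 0).hasTemperateGrowth i) l
  induction n generalizing I K with
  | zero =>
    refine ⟨fun x => (Function.HasTemperateGrowth.const _).fun_mul (tg x.1 x.2), fun p => ?_⟩
    -- The moment bound holds in `L^(2^(p+1))`; monotonicity of norms on a probability space brings
    -- it down to `2^p`.
    obtain ⟨C, hC, b⟩ := LocalizedBound.nrm_divergence_le p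
      (I := (i : I) × Fin (N i)) (fun x => hN x.1) (fun x => ht x.1) (K := K) (fun x => hS x.1)
      (fun n => (h n).reindex Sigma.fst) (fun x => x.2)
    refine ⟨C, hC, fun x L hL => ?_⟩
    obtain rfl : L = [] := List.length_eq_zero_iff.1 (by omega)
    simp only [iterPderiv]
    rw [nrm_const_mul, abs_of_nonneg (scale_nonneg _)]
    calc _ ≤ scale (N x.1) * (C * t x.1) :=
          mul_le_mul_of_nonneg_left ((nrm_le_of_le (Nat.le_succ p) (tg x.1 x.2)).trans (b x))
            (scale_nonneg _)
      _ = _ := by simp [siteWeight, sites]; ring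
  | succ n ih =>
    refine DerivBound.succ (fun x L => mul_nonneg (mul_nonneg (ht _)
      (pow_nonneg (scale_nonneg _) _)) (siteWeight_nonneg _ _)) ((ih hN ht hS h tg).of_le
        (Nat.zero_le n)) ?_
    let Z := (y : (i : I) × Fin (N i)) × (Fin (N y.1) × Fin (N y.1))
    have h1 := ih (I := (i : I) × (Fin (N i) × Fin (N i))) (fun x => hN x.1)
      (t := fun x => t x.1 * scale (N x.1)) (fun x => mul_nonneg (ht _) (scale_nonneg _))
      (K := K + 2) (fun x => (Finset.card_union_le _ _).trans
        (add_le_add (hS x.1) Finset.card_le_two)) (fun n => (h (n + 1)).pderiv)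
      (fun x l => hasTemperateGrowth_divergence
        (fun j => HasTemperateGrowth.pderiv ((h 0).hasTemperateGrowth x.1 j) _ _) l)
    have h2 := DerivBound.reindex h1 (fun z : Z => (⟨⟨z.1.1, z.2⟩, z.1.2⟩ :
      (x : (i : I) × (Fin (N i) × Fin (N i))) × Fin (N x.1)))
    have h3 : DerivBound (fun z : Z => N z.1.1) n (fun z g => scale (N z.1.1) *
        divergence z.1.2 (fun j => TAP.pderiv z.2.1 z.2.2 (u z.1.1 j)) g)
        (fun z L => t z.1.1 * scale (N z.1.1) ^ (z.2 :: L).length *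
          siteWeight (∅ ∪ sites (z.2 :: L)) z.1.2) := by
      refine DerivBound.mono h2 zero_le_one fun z L _ => ?_
      have hs := scale_nonneg (N z.1.1)
      have ht' := ht z.1.1
      rw [one_mul, List.length_cons, pow_succ']
      calc _ = t z.1.1 * (scale (N z.1.1) * scale (N z.1.1) ^ L.length) *
            siteWeight (∅ ∪ sites L) z.1.2 := by ring
        _ ≤ _ := by
          refine mul_le_mul_of_nonneg_left (siteWeight_mono ?_ _) (by positivity)
          exact Finset.union_subset_union_right (sites_mono (List.subset_cons_self _ _))
    -- The two commutator terms, with `a` and `b` the endpoints of the derivative in either order.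
    have key : ∀ (a b : (i : I) → Fin (N i) × Fin (N i) → Fin (N i)),
        (∀ i e, a i e = e.1 ∨ a i e = e.2) →
        DerivBound (fun z : Z => N z.1.1) n (fun z g =>
          (if z.2.1 ≠ z.2.2 ∧ z.1.2 = a z.1.1 z.2 then scale (N z.1.1) else 0) *
            u z.1.1 (b z.1.1 z.2) g)
        (fun z L => t z.1.1 * scale (N z.1.1) ^ (z.2 :: L).length *
          siteWeight (∅ ∪ sites (z.2 :: L)) z.1.2) := by
      intro a b ha
      have h4 := DerivBound.reindex (LocalizedBound.uniform ht (h n)) (fun z : Z =>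
        (⟨z.1.1, b z.1.1 z.2⟩ : (i : I) × Fin (N i)))
      refine (DerivBound.const_mul h4
        (c := fun z => if z.2.1 ≠ z.2.2 ∧ z.1.2 = a z.1.1 z.2 then scale (N z.1.1) else 0)
        (r := fun z => if z.1.2 = a z.1.1 z.2 then scale (N z.1.1) else 0) ?_).mono
        zero_le_one ?_
      · intro z
        have hs := scale_nonneg (N z.1.1)
        by_cases h5 : z.1.2 = a z.1.1 z.2
        · simp only [h5, and_true, if_true]
          split_ifs
          · rw [abs_of_nonneg hs]
          · simpa using hs
        · simp [h5]
      · intro z L _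
        have hs := scale_nonneg (N z.1.1)
        have ht' := ht z.1.1
        rw [one_mul]
        by_cases h5 : z.1.2 = a z.1.1 z.2
        · have h6 : z.1.2 ∈ ∅ ∪ sites (z.2 :: L) := by
            simp only [sites, Finset.mem_union, Finset.mem_insert]
            rcases ha z.1.1 z.2 with h7 | h7
            · exact Or.inr (Or.inl (h5.trans h7))
            · exact Or.inr (Or.inr (Or.inl (h5.trans h7)))
          rw [siteWeight_of_mem h6, if_pos h5, List.length_cons, pow_succ]
          exact le_of_eq (by ring)
        · rw [if_neg h5, zero_mul]
          exact mul_nonneg (mul_nonneg ht' (pow_nonneg hs _)) (siteWeight_nonneg _ _)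
    have h8 := h3.add ((key (fun _ e => e.1) (fun _ e => e.2) fun _ _ => Or.inl rfl).add
      (key (fun _ e => e.2) (fun _ e => e.1) fun _ _ => Or.inr rfl))
    convert! h8 using 2 with z
    rw [pderiv_const_mul (tg _ _), pderiv_divergence ((h 0).hasTemperateGrowth _)]
    ext g
    by_cases h9 : z.2.1 = z.2.2
    · simp [h9]
    · simp only [ne_eq, h9, not_false_eq_true, if_true, true_and, mul_add, ite_mul, zero_mul,
        mul_ite, mul_zero]

end LocalizedBounds

/-! ### Uniform bounds, products and composition with `tanh` -/

section UniformBounds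

variable {I : Type} {N : I → ℕ} {n : ℕ} {t t₁ t₂ : I → ℝ} {S : ∀ i, Finset (Fin (N i))}
  {u : ∀ i, Fin (N i) → Disorder (N i) → ℝ} {F G : ∀ i, Disorder (N i) → ℝ}

theorem iterPderiv_const {M : ℕ} (c : ℝ) (e : Fin M × Fin M) (L : List (Fin M × Fin M)) :
    iterPderiv (e :: L) (fun _ => c) = fun _ => 0 := by
  have h : ∀ c : ℝ, pderiv e.1 e.2 (fun _ : Disorder M => c) = fun _ => 0 :=
    fun c => funext fun g => pderiv_const _ _ c g
  rw [iterPderiv, h]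
  clear h
  induction L with
  | nil => rfl
  | cons e L ih =>
    rw [iterPderiv, show pderiv e.1 e.2 (fun _ : Disorder M => (0 : ℝ)) = fun _ => 0 from
      funext fun g => pderiv_const _ _ 0 g, ih]

theorem UniformBound.const (n : ℕ) {c : I → ℝ} (hc : ∀ i, |c i| ≤ t i) :
    UniformBound N n t (fun i _ => c i) := by
  refine ⟨fun i => Function.HasTemperateGrowth.const _, fun p => ⟨1, zero_le_one, fun i L _ => ?_⟩⟩
  cases L with
  | nil => simpa [iterPderiv, nrm_const] using hc i
  | cons e L =>
    rw [iterPderiv_const, nrm_const, abs_zero, one_mul]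
    exact mul_nonneg ((abs_nonneg _).trans (hc i)) (pow_nonneg (scale_nonneg _) _)

theorem UniformBound.mul (hF : UniformBound N n t₁ F) (hG : UniformBound N n t₂ G) :
    UniformBound N n (fun i => t₁ i * t₂ i) (fun i g => F i g * G i g) :=
  DerivBound.mul hF hG fun i A B L _ _ _ hAB => le_of_eq (by rw [← hAB, pow_add]; ring)

theorem UniformBound.const_mul (hF : UniformBound N n t F) {c r : I → ℝ}
    (hc : ∀ i, |c i| ≤ r i) : UniformBound N n (fun i => r i * t i) (fun i g => c i * F i g) :=
  DerivBound.mono (DerivBound.const_mul hF hc) zero_le_one fun i L _ => le_of_eq (by ring)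

theorem UniformBound.mono (hF : UniformBound N n t₁ F) {K : ℝ} (hK : 0 ≤ K)
    (ht : ∀ i, t₁ i ≤ K * t₂ i) : UniformBound N n t₂ F :=
  DerivBound.mono hF hK fun i L _ => by
    rw [← mul_assoc]
    exact mul_le_mul_of_nonneg_right (ht i) (pow_nonneg (scale_nonneg _) _)

theorem UniformBound.one_sub_sq (hF : UniformBound N n (fun _ => 1) F) :
    UniformBound N n (fun _ => 1) (fun i g => 1 - F i g ^ 2) := by
  have h1 := UniformBound.const_mul ((hF.mul hF).mono (t₂ := fun _ => 1) zero_le_one (by simp))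
    (c := fun _ => -1) (r := fun _ => 1) (by simp)
  have h2 := DerivBound.add (UniformBound.const (N := N) n (c := fun _ => 1) (t := fun _ => 1)
    (by simp)) (h1.mono (t₂ := fun _ => 1) zero_le_one (by simp))
  have e : (fun i g => 1 - F i g ^ 2) = fun i g => 1 + -1 * (F i g * F i g) := by
    funext i g
    ring
  rw [e]
  exact h2

/-- The bounds on the derivatives of `z` pass to `tanh (h + z)`, whatever the size of `z`. -/
theorem UniformBound.tanh {z : ∀ i, Disorder (N i) → ℝ} (hz : ∀ i, (z i).HasTemperateGrowth)
    (h : I → ℝ)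
    (hdz : ∀ n, UniformBound (fun x : (i : I) × (Fin (N i) × Fin (N i)) => N x.1) n
      (fun x => scale (N x.1)) (fun x => pderiv x.2.1 x.2.2 (z x.1))) (n : ℕ) :
    UniformBound N n (fun _ => 1) (fun i g => Real.tanh (h i + z i g)) := by
  have tz : ∀ i, (fun g => h i + z i g).HasTemperateGrowth := fun i =>
    (Function.HasTemperateGrowth.const _).fun_add (hz i)
  have tT : ∀ i, (fun g => Real.tanh (h i + z i g)).HasTemperateGrowth := fun i =>
    hasTemperateGrowth_tanh.comp (tz i)
  induction n with
  | zero =>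
    refine ⟨tT, fun p => ⟨1, zero_le_one, fun i L hL => ?_⟩⟩
    obtain rfl : L = [] := List.length_eq_zero_iff.1 (by omega)
    simpa [iterPderiv] using nrm_le_of_bounded (tT i) (fun g => (Real.abs_tanh_lt_one _).le) p
  | succ n ih =>
    refine DerivBound.succ (fun i L => mul_nonneg zero_le_one (pow_nonneg (scale_nonneg _) _))
      (DerivBound.of_le ih (Nat.zero_le n)) ?_
    have h1 := (DerivBound.reindex ih.one_sub_sq (fun x : (i : I) × (Fin (N i) × Fin (N i)) => x.1))
    -- The derivative is `(1 - tanh²) ∂z`: the first factor is controlled to order `n` by induction,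
    -- the second by hypothesis.
    have h2 := UniformBound.mul h1 (hdz n)
    have h3 := DerivBound.mono (w₂ := fun x L => 1 * scale (N x.1) ^ (x.2 :: L).length) h2
      zero_le_one fun x L _ => le_of_eq (by rw [List.length_cons, pow_succ]; ring)
    convert! h3 using 2 with x
    rw [pderiv_comp hasDerivAt_tanh (tz x.1),
      pderiv_add (Function.HasTemperateGrowth.const _) (hz x.1)]
    ext g
    simp [pderiv_const]

theorem LocalizedBound.uniform_mul {F : ∀ i, Fin (N i) → Disorder (N i) → ℝ}
    (ht : ∀ i, 0 ≤ t i)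
    (hF : UniformBound (fun x : (i : I) × Fin (N i) => N x.1) n (fun _ => 1)
      (fun x => F x.1 x.2)) (hu : LocalizedBound N n t S u) :
    LocalizedBound N n t S (fun i j g => F i j g * u i j g) :=
  DerivBound.mul hF hu fun x A B L _ _ hB hAB => by
    have hs := scale_nonneg (N x.1)
    have ht' := ht x.1
    rw [← hAB, pow_add]
    calc _ = t x.1 * (scale (N x.1) ^ A.length * scale (N x.1) ^ B.length) *
          siteWeight (S x.1 ∪ sites B) x.2 := by ring
      _ ≤ _ := mul_le_mul_of_nonneg_left
          (siteWeight_mono (Finset.union_subset_union_right (sites_mono hB)) _) (by positivity)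

end UniformBounds

/-! ### The TAP iteration and identities for its errors -/

section Iteration

/-- The data on which the constants do not depend. -/
structure Instance where
  /-- the form of the correction -/
  c : OnsagerChoice
  /-- the external field -/
  h : ℝ
  /-- the size of the system -/
  N : ℕ
  pos : 0 < N
  /-- the starting value -/
  a : Fin N → ℝ
  bdd : ∀ i, |a i| ≤ 1

/-- The argument of `tanh` without the external field. -/
def localField {N : ℕ} (c : OnsagerChoice) (β h : ℝ) (a : Fin N → ℝ) (k : ℕ) (l : Fin N)
    (g : Disorder N) : ℝ :=
  β * scale N * ∑ j, coupling g l j * mag c β h a k g j - onsager c β h a k g l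

section Single

variable {N : ℕ} (c : OnsagerChoice) (β h : ℝ) (a : Fin N → ℝ)

theorem div_sqrt_eq (β : ℝ) (N : ℕ) : β / √(N : ℝ) = β * scale N := by
  rw [scale, mul_one_div]

theorem mag_succ (k : ℕ) (l : Fin N) :
    (fun g => mag c β h a (k + 2) g l) =
      fun g => Real.tanh (h + localField c β h a (k + 1) l g) := by
  ext g
  rw [mag, div_sqrt_eq]
  rfl

theorem hasTemperateGrowth_onsagerOf {prev cur : Disorder N → Fin N → ℝ}
    (hp : ∀ i, (fun g => prev g i).HasTemperateGrowth)
    (hc : ∀ i, (fun g => cur g i).HasTemperateGrowth) (i : Fin N) :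
    (fun g => onsagerOf c β prev cur g i).HasTemperateGrowth := by
  cases c with
  | classical =>
    simp only [onsagerOf, overlap]
    exact ((Function.HasTemperateGrowth.const _).fun_mul
      ((Function.HasTemperateGrowth.const _).fun_sub
        ((Function.HasTemperateGrowth.const _).fun_mul
          (Function.HasTemperateGrowth.sum fun j _ => (hc j).fun_pow 2)))).fun_mul (hp i)
  | divergence =>
    simp only [onsagerOf]
    exact (Function.HasTemperateGrowth.const _).fun_mul
      (Function.HasTemperateGrowth.sum fun j _ => HasTemperateGrowth.pderiv (hc j) i j)

/-- Two consecutive iterates are treated together because the recursion has two steps. -/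
theorem hasTemperateGrowth_mag_pair (k : ℕ) :
    (∀ i, (fun g => mag c β h a k g i).HasTemperateGrowth) ∧
      ∀ i, (fun g => mag c β h a (k + 1) g i).HasTemperateGrowth := by
  induction k with
  | zero => exact ⟨fun i => by simp [mag], fun i => by simp [mag]⟩
  | succ k ih =>
    refine ⟨ih.2, fun i => ?_⟩
    rw [mag_succ]
    exact hasTemperateGrowth_tanh.comp ((Function.HasTemperateGrowth.const _).fun_add
      (((Function.HasTemperateGrowth.const _).fun_mul (Function.HasTemperateGrowth.sum fun j _ =>
        (hasTemperateGrowth_coupling i j).fun_mul (ih.2 j))).fun_sub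
          (hasTemperateGrowth_onsagerOf c β ih.1 ih.2 i)))

theorem hasTemperateGrowth_mag (k : ℕ) (i : Fin N) :
    (fun g => mag c β h a k g i).HasTemperateGrowth :=
  (hasTemperateGrowth_mag_pair c β h a k).1 i

theorem hasTemperateGrowth_onsager (k : ℕ) (i : Fin N) :
    (fun g => onsager c β h a k g i).HasTemperateGrowth :=
  hasTemperateGrowth_onsagerOf c β (hasTemperateGrowth_mag c β h a _)
    (hasTemperateGrowth_mag c β h a _) i

theorem hasTemperateGrowth_sum_coupling_mag (k : ℕ) (l : Fin N) :
    (fun g => ∑ j, coupling g l j * mag c β h a k g j).HasTemperateGrowth :=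
  Function.HasTemperateGrowth.sum fun j _ =>
    (hasTemperateGrowth_coupling l j).fun_mul (hasTemperateGrowth_mag c β h a k j)

theorem hasTemperateGrowth_localField (k : ℕ) (l : Fin N) :
    (localField c β h a k l).HasTemperateGrowth :=
  ((Function.HasTemperateGrowth.const _).fun_mul
    (hasTemperateGrowth_sum_coupling_mag c β h a k l)).fun_sub
      (hasTemperateGrowth_onsager c β h a k l)

/-- The derivative falls on the iterate and the correction, which gives `Δ`, or on a coupling, which
gives explicit terms at the sites `x` and `y` only. -/
theorem pderiv_localField (k : ℕ) (l x y : Fin N) (g : Disorder N) :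
    pderiv x y (localField c β h a k l) g =
      errorDelta c β h a k l x y g + β * scale N * if x ≠ y then
        (if l = x then mag c β h a k g y else 0) + (if l = y then mag c β h a k g x else 0)
        else 0 := by
  have tm := hasTemperateGrowth_mag c β h a k
  have h1 : ∀ j, pderiv x y (fun g => coupling g l j * mag c β h a k g j) g =
      coupling g l j * pderiv x y (fun g => mag c β h a k g j) g
      + (if x ≠ y ∧ ((l = x ∧ j = y) ∨ (l = y ∧ j = x)) then 1 else 0) * mag c β h a k g j := by
    intro j
    rw [pderiv_mul (hasTemperateGrowth_coupling l j) (tm j)]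
    simp only [pderiv_coupling]
    ring
  have h2 : ∑ j, (if x ≠ y ∧ ((l = x ∧ j = y) ∨ (l = y ∧ j = x)) then (1 : ℝ) else 0) *
      mag c β h a k g j = if x ≠ y then
        (if l = x then mag c β h a k g y else 0) + (if l = y then mag c β h a k g x else 0)
        else 0 := sum_indicator_mul l x y _
  have h3 := hasTemperateGrowth_sum_coupling_mag c β h a k l
  rw [show localField c β h a k l = fun g => β * scale N * (∑ j, coupling g l j *
    mag c β h a k g j) - onsager c β h a k g l from rfl,
    pderiv_sub ((Function.HasTemperateGrowth.const _).fun_mul h3)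
      (hasTemperateGrowth_onsager c β h a k l), pderiv_const_mul h3,
    pderiv_sum _ fun j => (hasTemperateGrowth_coupling l j).fun_mul (tm j)]
  simp only [h1, Finset.sum_add_distrib, h2]
  rw [errorDelta, div_sqrt_eq]
  ring

theorem pderiv_mag_succ (k : ℕ) (l x y : Fin N) :
    pderiv x y (fun g => mag c β h a (k + 2) g l) = fun g =>
      (1 - mag c β h a (k + 2) g l ^ 2) * pderiv x y (localField c β h a (k + 1) l) g := by
  have tz := hasTemperateGrowth_localField c β h a (k + 1) l
  have h1 := mag_succ c β h a k l
  rw [h1, pderiv_comp hasDerivAt_tanh ((Function.HasTemperateGrowth.const _).fun_add tz),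
    pderiv_add (Function.HasTemperateGrowth.const _) tz]
  ext g
  dsimp only
  rw [pderiv_const, zero_add, ← congrFun h1 g]

theorem errorE_eq (k : ℕ) (x : Fin N) :
    errorE c β h a k x = fun g => β * scale N *
      (∑ l, pderiv x l (fun g' => mag c β h a k g' l) g) - onsager c β h a k g x := by
  ext g
  rw [errorE, div_sqrt_eq]

theorem hasTemperateGrowth_sum_pderiv_mag (k : ℕ) (x : Fin N) :
    (fun g => ∑ l, pderiv x l (fun g' => mag c β h a k g' l) g).HasTemperateGrowth :=
  Function.HasTemperateGrowth.sum fun l _ =>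
    HasTemperateGrowth.pderiv (hasTemperateGrowth_mag c β h a k l) x l

theorem hasTemperateGrowth_errorE (k : ℕ) (x : Fin N) :
    (errorE c β h a k x).HasTemperateGrowth := by
  rw [errorE_eq]
  exact ((Function.HasTemperateGrowth.const _).fun_mul
    (hasTemperateGrowth_sum_pderiv_mag c β h a k x)).fun_sub
      (hasTemperateGrowth_onsager c β h a k x)

/-- Add and subtract the trace `∑ j, ∂_{lj} ∂_{xy} m j`: one copy completes the divergence, the
other is the derivative of the first part of `E`. -/
theorem errorDelta_eq (k : ℕ) (l x y : Fin N) (g : Disorder N) :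
    errorDelta c β h a k l x y g =
      β * (scale N * divergence l (fun j => pderiv x y (fun g' => mag c β h a k g' j)) g)
        + pderiv x y (errorE c β h a k l) g := by
  have tm := hasTemperateGrowth_mag c β h a k
  have t1 := hasTemperateGrowth_sum_pderiv_mag c β h a k l
  rw [errorE_eq, pderiv_sub ((Function.HasTemperateGrowth.const _).fun_mul t1)
    (hasTemperateGrowth_onsager c β h a k l), pderiv_const_mul t1,
    pderiv_sum _ fun j => HasTemperateGrowth.pderiv (tm j) l j, errorDelta, div_sqrt_eq]
  simp only [divergence, Finset.sum_sub_distrib, pderiv_comm (tm _) x y l]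
  ring

theorem errorE_divergence (k : ℕ) (x : Fin N) (g : Disorder N) :
    errorE .divergence β h a k x g = 0 := by
  simp [errorE, onsager, onsagerOf]

/-- Insert the formula for the derivative of `m`. Its explicit part sums to `β² (1 - q) m'`, the
Onsager term, except for the missing summand `l = x`; the rest is a sum of errors `Δ`. -/
theorem errorE_classical (hN : 0 < N) (k : ℕ) (x : Fin N) (g : Disorder N) :
    errorE .classical β h a (k + 2) x g =
      -(β ^ 2 * scale N ^ 2) * ((1 - mag .classical β h a (k + 2) g x ^ 2) *
          mag .classical β h a (k + 1) g x)
        + β * scale N * ∑ l, (1 - mag .classical β h a (k + 2) g l ^ 2) *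
          errorDelta .classical β h a (k + 1) l x l g := by
  rw [errorE_eq]
  set m := mag .classical β h a (k + 2) g with hm
  set m' := mag .classical β h a (k + 1) g with hm'
  have h1 : ∀ l, pderiv x l (fun g' => mag .classical β h a (k + 2) g' l) g =
      (1 - m l ^ 2) * errorDelta .classical β h a (k + 1) l x l g +
      β * scale N * m' x * ((1 - m l ^ 2) - if x = l then 1 - m l ^ 2 else 0) := by
    intro l
    rw [pderiv_mag_succ]
    dsimp only
    rw [pderiv_localField, ← hm, ← hm']
    by_cases hl : x = l
    · simp [hl]
    · simp [hl, Ne.symm hl]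
      ring
  simp only [h1, Finset.sum_add_distrib, ← Finset.mul_sum, Finset.sum_sub_distrib]
  have h2 : onsager .classical β h a (k + 2) g x =
      β ^ 2 * (1 - scale N ^ 2 * ∑ l, m l ^ 2) * m' x := by
    simp [onsager, onsagerOf, overlap, scale_sq, hm, hm']
  have h3 := natCast_mul_scale_sq hN
  rw [h2]
  simp
  -- The identity `N * scale N ^ 2 = 1` turns the sum of the constants `1` into the `1` of `1 - q`.
  linear_combination (β ^ 2 * m' x) * h3

end Single

end Iteration

/-! ### Induction on the iteration step -/

section BoundsForIterates

theorem LocalizedBound.mono_size {I : Type} {N : I → ℕ} {n : ℕ} {t₁ t₂ : I → ℝ}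
    {S : ∀ i, Finset (Fin (N i))} {u : ∀ i, Fin (N i) → Disorder (N i) → ℝ}
    (h : LocalizedBound N n t₁ S u) {K : ℝ} (hK : 0 ≤ K) (ht : ∀ i, t₁ i ≤ K * t₂ i) :
    LocalizedBound N n t₂ S u :=
  DerivBound.mono h hK fun x L _ => by
    rw [← mul_assoc, ← mul_assoc]
    exact mul_le_mul_of_nonneg_right (mul_le_mul_of_nonneg_right (ht _)
      (pow_nonneg (scale_nonneg _) _)) (siteWeight_nonneg _ _)

theorem UniformBound.localized {I : Type} {N : I → ℕ} {n : ℕ} {t r : I → ℝ}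
    {S : ∀ i, Finset (Fin (N i))} {F : ∀ i, Disorder (N i) → ℝ} (hr : ∀ i, 0 ≤ r i)
    (hF : UniformBound N n t F) {c : ∀ i, Fin (N i) → ℝ}
    (hc : ∀ i l, |c i l| ≤ if l ∈ S i then r i else 0) (ht : ∀ i, 0 ≤ t i) :
    LocalizedBound N n (fun i => r i * t i) S (fun i l g => c i l * F i g) := by
  have h1 := DerivBound.const_mul (DerivBound.reindex hF
    (fun x : (i : I) × Fin (N i) => x.1)) (fun x => hc x.1 x.2)
  refine DerivBound.mono h1 zero_le_one fun x L _ => ?_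
  have hs := scale_nonneg (N x.1)
  have ht' := ht x.1
  have hr' := hr x.1
  rw [one_mul]
  split_ifs with hx
  · rw [siteWeight_of_mem (Finset.mem_union_left _ hx)]
    exact le_of_eq (by ring)
  · rw [zero_mul]
    exact mul_nonneg (by positivity) (siteWeight_nonneg _ _)

/-- The a priori bounds on the iterate `m^(k)` and the error `E^(k)`. -/
structure IterateBounds (β : ℝ) (k : ℕ) : Prop where
  mag : ∀ n, UniformBound (fun x : (θ : Instance) × Fin θ.N => x.1.N) n (fun _ => 1)
    (fun x g => mag x.1.c β x.1.h x.1.a k g x.2)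
  pderiv_mag : ∀ n, LocalizedBound
    (fun x : (θ : Instance) × (Fin θ.N × Fin θ.N) => x.1.N) n (fun x => scale x.1.N)
    (fun x => {x.2.1, x.2.2})
    (fun x j => pderiv x.2.1 x.2.2 (fun g => TAP.mag x.1.c β x.1.h x.1.a k g j))
  errorE : ∀ n, UniformBound (fun x : (θ : Instance) × Fin θ.N => x.1.N) n
    (fun x => scale x.1.N) (fun x => errorE x.1.c β x.1.h x.1.a k x.2)

variable {β : ℝ} {k : ℕ}

/-- Both parts of `errorDelta_eq` have order `scale N ^ 2`: one factor comes from the size of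
`∂_{yz} m` or of `E`, the other from the prefactor of the divergence or from the derivative of `E`.
-/
theorem IterateBounds.errorDelta (H : IterateBounds β k) (n : ℕ) :
    LocalizedBound (fun x : (θ : Instance) × (Fin θ.N × Fin θ.N) => x.1.N) n
      (fun x => scale x.1.N) (fun _ => ∅)
      (fun x l => errorDelta x.1.c β x.1.h x.1.a k l x.2.1 x.2.2) := by
  let Z := (x : (θ : Instance) × (Fin θ.N × Fin θ.N)) × Fin x.1.N
  have h1 := LocalizedBound.scale_mul_divergence n (K := 2) (fun x => x.1.pos)
    (fun x => scale_nonneg _) (fun x => Finset.card_le_two) H.pderiv_mag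
  have h2 := DerivBound.const_mul h1 (c := fun _ => β) (r := fun _ => |β|) (fun _ => le_rfl)
  have h3 := h2.mono (w₂ := fun x L => scale x.1.1.N * scale x.1.1.N ^ L.length *
    siteWeight (∅ ∪ sites L) x.2) (abs_nonneg β) fun x L _ => le_rfl
  have h4 := (DerivBound.pderiv (H.errorE (n + 1))).reindex (fun z : Z =>
    (⟨⟨z.1.1, z.2⟩, z.1.2⟩ : (y : (θ : Instance) × Fin θ.N) × (Fin y.1.N × Fin y.1.N)))
  have h5 := h4.mono (w₂ := fun x L => scale x.1.1.N * scale x.1.1.N ^ L.length *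
    siteWeight (∅ ∪ sites L) x.2) zero_le_one fun x L _ => by
      rw [one_mul, List.length_cons, pow_succ, ← mul_assoc]
      exact mul_le_mul_of_nonneg_left (scale_le_siteWeight _ _)
        (mul_nonneg (scale_nonneg _) (pow_nonneg (scale_nonneg _) _))
  have h6 := h3.add h5
  unfold LocalizedBound
  convert! h6 using 2 with z
  ext g
  exact errorDelta_eq _ _ _ _ _ _ _ _ _

theorem IterateBounds.pderiv_localField (H : IterateBounds β k) (n : ℕ) :
    LocalizedBound (fun x : (θ : Instance) × (Fin θ.N × Fin θ.N) => x.1.N) n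
      (fun x => scale x.1.N) (fun x => {x.2.1, x.2.2})
      (fun x l => pderiv x.2.1 x.2.2 (localField x.1.c β x.1.h x.1.a k l)) := by
  have h1 := LocalizedBound.mono_set (fun x => scale_nonneg _) (H.errorDelta n)
    (T := fun x => {x.2.1, x.2.2}) (fun x => Finset.empty_subset _)
  have key : ∀ (a b : (θ : Instance) → Fin θ.N × Fin θ.N → Fin θ.N),
      (∀ θ e, a θ e = e.1 ∨ a θ e = e.2) →
      LocalizedBound (fun x : (θ : Instance) × (Fin θ.N × Fin θ.N) => x.1.N) n
        (fun x => scale x.1.N) (fun x => {x.2.1, x.2.2})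
        (fun x l g => (if x.2.1 ≠ x.2.2 ∧ l = a x.1 x.2 then β * scale x.1.N else 0) *
          TAP.mag x.1.c β x.1.h x.1.a k g (b x.1 x.2)) := by
    intro a b ha
    have h2 := DerivBound.reindex (H.mag n) (fun x : (θ : Instance) × (Fin θ.N × Fin θ.N) =>
      (⟨x.1, b x.1 x.2⟩ : (θ : Instance) × Fin θ.N))
    have h3 := UniformBound.localized (r := fun x => |β| * scale x.1.N)
      (S := fun x => {x.2.1, x.2.2}) (fun x => mul_nonneg (abs_nonneg _) (scale_nonneg _)) h2
      (c := fun x l => if x.2.1 ≠ x.2.2 ∧ l = a x.1 x.2 then β * scale x.1.N else 0)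
      (fun x l => by
        have hs := scale_nonneg x.1.N
        by_cases hl : l = a x.1 x.2
        · have : l ∈ ({x.2.1, x.2.2} : Finset (Fin x.1.N)) := by
            rcases ha x.1 x.2 with h | h <;> simp [hl, h]
          rw [if_pos this]
          split_ifs
          · rw [abs_mul, abs_of_nonneg hs]
          · rw [abs_zero]; positivity
        · simp only [hl, and_false, if_false, abs_zero]
          split_ifs <;> positivity) (fun _ => zero_le_one)
    exact h3.mono_size (abs_nonneg β) fun x => by rw [mul_one]
  have h4 := DerivBound.add h1 (DerivBound.add
    (key (fun _ e => e.1) (fun _ e => e.2) fun _ _ => Or.inl rfl)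
    (key (fun _ e => e.2) (fun _ e => e.1) fun _ _ => Or.inr rfl))
  unfold LocalizedBound
  convert! h4 using 2 with z
  ext g
  dsimp only
  rw [TAP.pderiv_localField]
  by_cases h : z.1.2.1 = z.1.2.2
  · simp [h]
  · simp only [ne_eq, h, not_false_eq_true, if_true, true_and, mul_add, ite_mul, zero_mul,
      mul_ite, mul_zero]

theorem DerivBound.zero {I : Type} {N : I → ℕ} (n : ℕ)
    {w : ∀ i, List (Fin (N i) × Fin (N i)) → ℝ} (hw : ∀ i L, 0 ≤ w i L) :
    DerivBound N n (fun _ _ => 0) w :=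
  DerivBound.mono (UniformBound.const n (c := fun _ => 0) (t := fun _ => 0) (by simp)) zero_le_one
    fun i L _ => by simpa using hw i L

/-- The start is constant in the disorder and `m^(0) = 0`, so the derivatives and both forms of the
correction vanish. -/
theorem iterateBounds_one (β : ℝ) : IterateBounds β 1 where
  mag n := UniformBound.const n fun x => x.1.bdd x.2
  pderiv_mag n := by
    have : (fun (x : (θ : Instance) × (Fin θ.N × Fin θ.N)) (j : Fin x.1.N) =>
        pderiv x.2.1 x.2.2 (fun g => TAP.mag x.1.c β x.1.h x.1.a 1 g j)) = fun x j _ => 0 := by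
      funext x j g
      exact pderiv_const _ _ _ _
    rw [this]
    exact DerivBound.zero n fun x L => mul_nonneg (mul_nonneg (scale_nonneg _)
      (pow_nonneg (scale_nonneg _) _)) (siteWeight_nonneg _ _)
  errorE n := by
    have : (fun x : (θ : Instance) × Fin θ.N => TAP.errorE x.1.c β x.1.h x.1.a 1 x.2) =
        fun x _ => 0 := by
      funext x g
      have h : ∀ l, pderiv x.2 l (fun g' => TAP.mag x.1.c β x.1.h x.1.a 1 g' l) g = 0 :=
        fun l => pderiv_const _ _ _ _
      rw [TAP.errorE]
      simp only [h, Finset.sum_const_zero, mul_zero, zero_sub, neg_eq_zero, onsager]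
      cases x.1.c with
      | classical => simp [onsagerOf, TAP.mag]
      | divergence => simp [onsagerOf, TAP.mag, pderiv_const]
    rw [this]
    exact DerivBound.zero n fun x L => mul_nonneg (scale_nonneg _) (pow_nonneg (scale_nonneg _) _)

/-- The indicator of the first choice of the correction. -/
def OnsagerChoice.indicator : OnsagerChoice → ℝ
  | .classical => 1
  | .divergence => 0

theorem IterateBounds.succ (H : IterateBounds β (k + 1)) : IterateBounds β (k + 2) := by
  have hm : ∀ n, UniformBound (fun x : (θ : Instance) × Fin θ.N => x.1.N) n (fun _ => 1)
      (fun x g => TAP.mag x.1.c β x.1.h x.1.a (k + 2) g x.2) := by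
    intro n
    have h1 := UniformBound.tanh (I := (θ : Instance) × Fin θ.N) (N := fun x => x.1.N)
      (z := fun x => localField x.1.c β x.1.h x.1.a (k + 1) x.2)
      (fun x => hasTemperateGrowth_localField _ _ _ _ _ _) (fun x => x.1.h)
      (fun n => DerivBound.reindex
        (LocalizedBound.uniform (fun x => scale_nonneg _) (H.pderiv_localField n))
        (fun z : (x : (θ : Instance) × Fin θ.N) × (Fin x.1.N × Fin x.1.N) =>
          (⟨⟨z.1.1, z.2⟩, z.1.2⟩ : (x : (θ : Instance) × (Fin θ.N × Fin θ.N)) × Fin x.1.N))) n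
    have e : (fun (x : (θ : Instance) × Fin θ.N) g =>
        TAP.mag x.1.c β x.1.h x.1.a (k + 2) g x.2) = fun x g =>
          Real.tanh (x.1.h + localField x.1.c β x.1.h x.1.a (k + 1) x.2 g) :=
      funext fun x => mag_succ _ _ _ _ _ _
    rw [e]
    exact h1
  refine ⟨hm, fun n => ?_, fun n => ?_⟩
  · have h1 := LocalizedBound.uniform_mul (fun x => scale_nonneg _)
      (F := fun (x : (θ : Instance) × (Fin θ.N × Fin θ.N)) j g =>
        1 - TAP.mag x.1.c β x.1.h x.1.a (k + 2) g j ^ 2)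
      (DerivBound.reindex (hm n).one_sub_sq
        (fun z : (x : (θ : Instance) × (Fin θ.N × Fin θ.N)) × Fin x.1.N =>
          (⟨z.1.1, z.2⟩ : (θ : Instance) × Fin θ.N))) (H.pderiv_localField n)
    have e : (fun (x : (θ : Instance) × (Fin θ.N × Fin θ.N)) (j : Fin x.1.N) =>
        pderiv x.2.1 x.2.2 (fun g => TAP.mag x.1.c β x.1.h x.1.a (k + 2) g j)) =
        fun x j g => (1 - TAP.mag x.1.c β x.1.h x.1.a (k + 2) g j ^ 2) *
          pderiv x.2.1 x.2.2 (localField x.1.c β x.1.h x.1.a (k + 1) j) g :=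
      funext fun x => funext fun j => pderiv_mag_succ _ _ _ _ _ _ _ _
    rw [e]
    exact h1
  · have h1 := UniformBound.const_mul
      (UniformBound.mul (hm n).one_sub_sq (H.mag n))
      (c := fun x => -(β ^ 2 * scale x.1.N ^ 2)) (r := fun x => β ^ 2 * scale x.1.N ^ 2)
      (fun x => by
        have := scale_nonneg x.1.N
        rw [abs_neg, abs_of_nonneg (by positivity)])
    have h2 := h1.mono (t₂ := fun x => scale x.1.N) (sq_nonneg β) fun x => by
      have h3 := scale_le_one x.1.N
      have h4 := scale_nonneg x.1.N
      rw [mul_one, mul_one]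
      refine mul_le_mul_of_nonneg_left ?_ (sq_nonneg β)
      nlinarith
    have h5 := LocalizedBound.uniform_mul (I := (θ : Instance) × Fin θ.N) (N := fun x => x.1.N)
      (t := fun x => scale x.1.N) (S := fun _ => ∅) (fun x => scale_nonneg _)
      (F := fun x l g => 1 - TAP.mag x.1.c β x.1.h x.1.a (k + 2) g l ^ 2)
      (u := fun x l => TAP.errorDelta x.1.c β x.1.h x.1.a (k + 1) l x.2 l)
      (DerivBound.reindex (hm n).one_sub_sq
        (fun z : (x : (θ : Instance) × Fin θ.N) × Fin x.1.N =>
          (⟨z.1.1, z.2⟩ : (θ : Instance) × Fin θ.N)))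
      (DerivBound.reindex (H.errorDelta n)
        (fun z : (x : (θ : Instance) × Fin θ.N) × Fin x.1.N =>
          (⟨⟨z.1.1, (z.1.2, z.2)⟩, z.2⟩ :
            (x : (θ : Instance) × (Fin θ.N × Fin θ.N)) × Fin x.1.N)))
    -- Each of the `N` summands has order `scale N ^ 2`, so the sum has order one. Derivatives of
    -- order at most `n` touch at most `2n` sites, whence the constant `2n + 1`.
    have h6 : UniformBound (fun x : (θ : Instance) × Fin θ.N => x.1.N) n (fun _ => 1)
        (fun x g => ∑ l, (1 - TAP.mag x.1.c β x.1.h x.1.a (k + 2) g l ^ 2) *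
          TAP.errorDelta x.1.c β x.1.h x.1.a (k + 1) l x.2 l g) := by
      refine DerivBound.sum (J := fun x : (θ : Instance) × Fin θ.N => Fin x.1.N)
        (F := fun x l g => (1 - TAP.mag x.1.c β x.1.h x.1.a (k + 2) g l ^ 2) *
          TAP.errorDelta x.1.c β x.1.h x.1.a (k + 1) l x.2 l g) h5
        (K := 2 * n + 1) (by positivity) fun x L hL => ?_
      dsimp only
      rw [← Finset.mul_sum, one_mul]
      have h7 := scale_mul_sum_siteWeight_le x.1.pos (∅ ∪ sites L)
      have h8 : ((∅ ∪ sites L).card : ℝ) ≤ 2 * n := by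
        rw [Finset.empty_union]
        have := card_sites_le L
        have : (sites L).card ≤ 2 * n := by omega
        exact_mod_cast this
      calc _ = (scale x.1.N * ∑ l, siteWeight (∅ ∪ sites L) l) * scale x.1.N ^ L.length := by ring
        _ ≤ _ := mul_le_mul_of_nonneg_right (by linarith) (pow_nonneg (scale_nonneg _) _)
    have h9 := (UniformBound.const_mul h6 (c := fun x => β * scale x.1.N)
      (r := fun x => |β| * scale x.1.N) (fun x => by
        rw [abs_mul, abs_of_nonneg (scale_nonneg _)])).mono (t₂ := fun x => scale x.1.N)
        (abs_nonneg β) fun x => by rw [mul_one]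
    -- Multiplying by the indicator puts both choices into one family, since `E` is zero for the
    -- second.
    have h10 := (UniformBound.const_mul (DerivBound.add h2 h9)
      (c := fun x => x.1.c.indicator) (r := fun _ => 1) (fun x => by
        cases x.1.c <;> simp [OnsagerChoice.indicator])).mono (t₂ := fun x => scale x.1.N)
          zero_le_one fun x => le_rfl
    convert! h10 using 2 with x
    ext g
    obtain ⟨⟨c, h, N, hN, a, ha⟩, l⟩ := x
    cases c with
    | classical => simp only [OnsagerChoice.indicator, one_mul, errorE_classical β h a hN]
    | divergence => simp only [OnsagerChoice.indicator, zero_mul, errorE_divergence]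

theorem iterateBounds (β : ℝ) (k : ℕ) : IterateBounds β (k + 1) := by
  induction k with
  | zero => exact iterateBounds_one β
  | succ k ih => exact ih.succ

/-- The case of no derivatives in `L²`: with no distinguished site the weight is `scale N * scale N
= 1 / N`. -/
theorem exists_integral_errorDelta_sq_le (β : ℝ) (k : ℕ) :
    ∃ C, 0 ≤ C ∧ ∀ (θ : Instance) (x y z : Fin θ.N),
      ∫ g, errorDelta θ.c β θ.h θ.a (k + 1) x y z g ^ 2 ∂gauss θ.N ≤ C / (θ.N : ℝ) ^ 2 := by
  obtain ⟨C, hC, b⟩ := ((iterateBounds β k).errorDelta 0).2 1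
  refine ⟨C ^ 2, sq_nonneg C, fun θ x y z => ?_⟩
  have h1 := b ⟨⟨θ, (y, z)⟩, x⟩ [] le_rfl
  have h2 := nrm_pow (((iterateBounds β k).errorDelta 0).1 ⟨⟨θ, (y, z)⟩, x⟩) 1
  simp only [pow_one, sq_abs] at h2
  rw [← h2]
  have h3 : nrm 1 (errorDelta θ.c β θ.h θ.a (k + 1) x y z) ≤ C * (scale θ.N * scale θ.N) := by
    simpa [iterPderiv, sites, siteWeight] using h1
  refine (pow_le_pow_left₀ (nrm_nonneg _ _) h3 2).trans (le_of_eq ?_)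
  rw [← sq, scale_sq]
  ring

theorem exists_integral_errorE_sq_le (β : ℝ) (k : ℕ) :
    ∃ C, 0 ≤ C ∧ ∀ (θ : Instance) (x : Fin θ.N),
      ∫ g, errorE θ.c β θ.h θ.a (k + 1) x g ^ 2 ∂gauss θ.N ≤ C / (θ.N : ℝ) := by
  obtain ⟨C, hC, b⟩ := ((iterateBounds β k).errorE 0).2 1
  refine ⟨C ^ 2, sq_nonneg C, fun θ x => ?_⟩
  have h1 := b ⟨θ, x⟩ [] le_rfl
  have h2 := nrm_pow (((iterateBounds β k).errorE 0).1 ⟨θ, x⟩) 1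
  simp only [pow_one, sq_abs] at h2
  rw [← h2]
  have h3 : nrm 1 (errorE θ.c β θ.h θ.a (k + 1) x) ≤ C * scale θ.N := by
    simpa [iterPderiv] using h1
  refine (pow_le_pow_left₀ (nrm_nonneg _ _) h3 2).trans (le_of_eq ?_)
  rw [mul_pow, scale_sq]
  ring

end BoundsForIterates

/-! ### Joint smoothness in the starting value and the disorder -/

section RandomStart

variable {N : ℕ}

/-- A partial derivative in the disorder is the full derivative in direction `(0, direction i j)`.
Joint smoothness is needed for the errors to be measurable when the start is random. -/
theorem contDiff_pderiv_param {F : (Fin N → ℝ) → Disorder N → ℝ}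
    (hF : ContDiff ℝ ((⊤ : ℕ∞) : WithTop ℕ∞)
      (fun q : (Fin N → ℝ) × Disorder N => F q.1 q.2)) (i j : Fin N) :
    ContDiff ℝ ((⊤ : ℕ∞) : WithTop ℕ∞)
      (fun q : (Fin N → ℝ) × Disorder N => pderiv i j (F q.1) q.2) := by
  set Φ := fun q : (Fin N → ℝ) × Disorder N => F q.1 q.2
  have hd : Differentiable ℝ Φ := hF.differentiable (by simp)
  have h1 : (fun q : (Fin N → ℝ) × Disorder N => pderiv i j (F q.1) q.2) =
      fun q => fderiv ℝ Φ q (0, direction i j) := by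
    ext ⟨a, g⟩
    have h2 : ∀ g, HasFDerivAt (F a)
        ((fderiv ℝ Φ (a, g)).comp (ContinuousLinearMap.inr ℝ (Fin N → ℝ) (Disorder N))) g := by
      intro g
      exact (hd (a, g)).hasFDerivAt.comp g (hasFDerivAt_prodMk_right a g)
    dsimp only
    rw [pderiv_eq_fderiv (fun g => (h2 g).differentiableAt), (h2 g).fderiv]
    rfl
  rw [h1]
  exact (hF.fderiv_right (m := ((⊤ : ℕ∞) : WithTop ℕ∞)) (by simp)).clm_apply contDiff_const

theorem contDiff_coupling (i j : Fin N) {n : WithTop ℕ∞} :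
    ContDiff ℝ n (fun q : (Fin N → ℝ) × Disorder N => coupling q.2 i j) := by
  unfold coupling
  split_ifs with h
  · fun_prop
  · exact contDiff_const

theorem contDiff_onsagerOf (c : OnsagerChoice) (β : ℝ)
    {prev cur : (Fin N → ℝ) → Disorder N → Fin N → ℝ}
    (hp : ∀ i, ContDiff ℝ ((⊤ : ℕ∞) : WithTop ℕ∞)
      (fun q : (Fin N → ℝ) × Disorder N => prev q.1 q.2 i))
    (hc : ∀ i, ContDiff ℝ ((⊤ : ℕ∞) : WithTop ℕ∞)
      (fun q : (Fin N → ℝ) × Disorder N => cur q.1 q.2 i)) (i : Fin N) :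
    ContDiff ℝ ((⊤ : ℕ∞) : WithTop ℕ∞)
      (fun q : (Fin N → ℝ) × Disorder N => onsagerOf c β (prev q.1) (cur q.1) q.2 i) := by
  cases c with
  | classical =>
    simp only [onsagerOf, overlap]
    exact (contDiff_const.mul (contDiff_const.sub (contDiff_const.mul
      (ContDiff.sum fun j _ => (hc j).pow 2)))).mul (hp i)
  | divergence =>
    simp only [onsagerOf]
    exact contDiff_const.mul (ContDiff.sum fun j _ =>
      contDiff_pderiv_param (F := fun a g => cur a g j) (hc j) i j)

variable (c : OnsagerChoice) (β h : ℝ)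

theorem contDiff_mag_pair (k : ℕ) :
    (∀ i : Fin N, ContDiff ℝ ((⊤ : ℕ∞) : WithTop ℕ∞)
      (fun q : (Fin N → ℝ) × Disorder N => mag c β h q.1 k q.2 i)) ∧
    ∀ i : Fin N, ContDiff ℝ ((⊤ : ℕ∞) : WithTop ℕ∞)
      (fun q : (Fin N → ℝ) × Disorder N => mag c β h q.1 (k + 1) q.2 i) := by
  induction k with
  | zero =>
    refine ⟨fun i => by simpa only [mag] using contDiff_const, fun i => ?_⟩
    simp only [mag]
    fun_prop
  | succ k ih =>
    refine ⟨ih.2, fun i => ?_⟩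
    simp only [mag]
    exact contDiff_tanh.comp (contDiff_const.add ((contDiff_const.mul (ContDiff.sum fun j _ =>
      (contDiff_coupling i j).mul (ih.2 j))).sub (contDiff_onsagerOf c β
        (prev := fun a => mag c β h a k) (cur := fun a => mag c β h a (k + 1)) ih.1 ih.2 i)))

theorem contDiff_mag (k : ℕ) (i : Fin N) : ContDiff ℝ ((⊤ : ℕ∞) : WithTop ℕ∞)
    (fun q : (Fin N → ℝ) × Disorder N => mag c β h q.1 k q.2 i) :=
  (contDiff_mag_pair c β h k).1 i

theorem contDiff_onsager (k : ℕ) (i : Fin N) : ContDiff ℝ ((⊤ : ℕ∞) : WithTop ℕ∞)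
    (fun q : (Fin N → ℝ) × Disorder N => onsager c β h q.1 k q.2 i) :=
  contDiff_onsagerOf c β (prev := fun a => mag c β h a (k - 1)) (cur := fun a => mag c β h a k)
    (contDiff_mag c β h (k - 1)) (contDiff_mag c β h k) i

theorem contDiff_errorDelta (k : ℕ) (x y z : Fin N) : ContDiff ℝ ((⊤ : ℕ∞) : WithTop ℕ∞)
    (fun q : (Fin N → ℝ) × Disorder N => errorDelta c β h q.1 k x y z q.2) :=
  (contDiff_const.mul (ContDiff.sum fun l _ => (contDiff_coupling x l).mul
    (contDiff_pderiv_param (F := fun a g => mag c β h a k g l) (contDiff_mag c β h k l) y z))).sub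
    (contDiff_pderiv_param (F := fun a g => onsager c β h a k g x) (contDiff_onsager c β h k x) y z)

theorem contDiff_errorE (k : ℕ) (x : Fin N) : ContDiff ℝ ((⊤ : ℕ∞) : WithTop ℕ∞)
    (fun q : (Fin N → ℝ) × Disorder N => errorE c β h q.1 k x q.2) :=
  (contDiff_const.mul (ContDiff.sum fun l _ =>
    contDiff_pderiv_param (F := fun a g => mag c β h a k g l) (contDiff_mag c β h k l) x l)).sub
    (contDiff_onsager c β h k x)

theorem hasTemperateGrowth_errorDelta (a : Fin N → ℝ) (k : ℕ) (x y z : Fin N) :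
    (errorDelta c β h a k x y z).HasTemperateGrowth :=
  ((Function.HasTemperateGrowth.const _).fun_mul (Function.HasTemperateGrowth.sum fun l _ =>
    (hasTemperateGrowth_coupling x l).fun_mul
      (HasTemperateGrowth.pderiv (hasTemperateGrowth_mag c β h a k l) y z))).fun_sub
    (HasTemperateGrowth.pderiv (hasTemperateGrowth_onsager c β h a k x) y z)

end RandomStart

/-! ### Conditioning on an independent starting value -/

section Conditioning

variable {Ω : Type*} [MeasurableSpace Ω] {P : Measure Ω} [IsProbabilityMeasure P]

theorem map_eq_stdGauss {ι : Type*} [Fintype ι] {g : ι → Ω → ℝ} (hm : ∀ e, Measurable (g e))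
    (hg : ∀ e, P.map (g e) = gaussianReal 0 1) (hi : iIndepFun g P) :
    P.map (fun ω e => g e ω) = stdGauss ι := by
  rw [(iIndepFun_iff_map_fun_eq_pi_map fun e => (hm e).aemeasurable).1 hi, stdGauss]
  simp only [hg]

/-- A bound on the second moment that holds for every value of an independent variable holds for
the random value. -/
theorem integrable_sq_and_integral_le {A D : Type*} [MeasurableSpace A] [MeasurableSpace D]
    {X : Ω → A} {Y : Ω → D} (hX : Measurable X) (hY : Measurable Y) (hXY : IndepFun X Y P)
    {f : A × D → ℝ} (hf : Measurable f) {B : ℝ} (hB : 0 ≤ B)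
    (hint : ∀ ω, Integrable (fun y => f (X ω, y) ^ 2) (P.map Y))
    (hle : ∀ ω, ∫ y, f (X ω, y) ^ 2 ∂P.map Y ≤ B) :
    Integrable (fun ω => f (X ω, Y ω) ^ 2) P ∧ ∫ ω, f (X ω, Y ω) ^ 2 ∂P ≤ B := by
  have : IsProbabilityMeasure (P.map Y) := Measure.isProbabilityMeasure_map hY.aemeasurable
  have hlaw := (indepFun_iff_map_prod_eq_prod_map_map hX.aemeasurable hY.aemeasurable).1 hXY
  have hF : Measurable (fun q : A × D => ENNReal.ofReal (f q ^ 2)) :=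
    (hf.pow_const 2).ennreal_ofReal
  -- Tonelli for the lower integral needs no integrability in advance, and the finite bound then
  -- provides it.
  have h1 : ∫⁻ ω, ENNReal.ofReal (f (X ω, Y ω) ^ 2) ∂P ≤ ENNReal.ofReal B := by
    calc ∫⁻ ω, ENNReal.ofReal (f (X ω, Y ω) ^ 2) ∂P
        = ∫⁻ q, ENNReal.ofReal (f q ^ 2) ∂P.map (fun ω => (X ω, Y ω)) :=
          (lintegral_map hF (hX.prodMk hY)).symm
      _ = ∫⁻ x, ∫⁻ y, ENNReal.ofReal (f (x, y) ^ 2) ∂P.map Y ∂P.map X := by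
          rw [hlaw, lintegral_prod _ hF.aemeasurable]
      _ = ∫⁻ ω, ∫⁻ y, ENNReal.ofReal (f (X ω, y) ^ 2) ∂P.map Y ∂P :=
          lintegral_map hF.lintegral_prod_right' hX
      _ ≤ ∫⁻ _, ENNReal.ofReal B ∂P := by
          refine lintegral_mono fun ω => ?_
          rw [← ofReal_integral_eq_lintegral_ofReal (hint ω)
            (Filter.Eventually.of_forall fun y => sq_nonneg _)]
          exact ENNReal.ofReal_le_ofReal (hle ω)
      _ = ENNReal.ofReal B := by simp
  have hmeas : Measurable (fun ω => f (X ω, Y ω) ^ 2) := (hf.comp (hX.prodMk hY)).pow_const 2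
  have hnn : 0 ≤ᵐ[P] fun ω => f (X ω, Y ω) ^ 2 := Filter.Eventually.of_forall fun ω => sq_nonneg _
  refine ⟨⟨hmeas.aestronglyMeasurable, ?_⟩, ?_⟩
  · rw [hasFiniteIntegral_iff_ofReal hnn]
    exact h1.trans_lt ENNReal.ofReal_lt_top
  · rw [integral_eq_lintegral_of_nonneg_ae hnn hmeas.aestronglyMeasurable]
    exact ENNReal.toReal_le_of_le_ofReal hB h1

end Conditioning

end TAP

end

/-! ### The estimates for random starting values -/

theorem theorem4p2 (β : ℝ) (k : ℕ) (hk : 1 ≤ k) :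
    ∃ C : ℝ, 0 < C ∧
      ∀ (c : TAP.OnsagerChoice) (h : ℝ) (N : ℕ)
        (Ω : Type*) [MeasurableSpace Ω] (P : Measure Ω) [IsProbabilityMeasure P]
        (g : TAP.Edge N → Ω → ℝ) (m₁ : Ω → Fin N → ℝ),
        (∀ e, Measurable (g e)) → (∀ e, P.map (g e) = gaussianReal 0 1) → iIndepFun g P →
        Measurable m₁ → (∀ ω i, m₁ ω i ∈ Set.Icc (-1 : ℝ) 1) →
        IndepFun m₁ (fun ω e => g e ω) P →
        (∀ x y z : Fin N, y ≠ z →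
          Integrable (fun ω => TAP.errorDelta c β h (m₁ ω) k x y z (fun e => g e ω) ^ 2) P ∧
          ∫ ω, TAP.errorDelta c β h (m₁ ω) k x y z (fun e => g e ω) ^ 2 ∂P ≤ C / (N : ℝ) ^ 2) ∧
        (∀ x : Fin N,
          Integrable (fun ω => TAP.errorE c β h (m₁ ω) k x (fun e => g e ω) ^ 2) P ∧
          ∫ ω, TAP.errorE c β h (m₁ ω) k x (fun e => g e ω) ^ 2 ∂P ≤ C / (N : ℝ)) := by
  obtain ⟨k, rfl⟩ : ∃ l, k = l + 1 := ⟨k - 1, by omega⟩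
  obtain ⟨C₁, h₁, b₁⟩ := TAP.exists_integral_errorDelta_sq_le β k
  obtain ⟨C₂, h₂, b₂⟩ := TAP.exists_integral_errorE_sq_le β k
  -- One constant for both estimates; the `1` makes it strictly positive.
  refine ⟨C₁ + C₂ + 1, by positivity, ?_⟩
  intro c h N Ω _ P _ g m₁ hgm hg hgi hm hm₁ hind
  have hY : Measurable (fun ω e => g e ω) := measurable_pi_lambda _ hgm
  have hlaw := TAP.map_eq_stdGauss hgm hg hgi
  constructor
  · intro x y z _
    refine TAP.integrable_sq_and_integral_le hm hY hind
      (TAP.contDiff_errorDelta c β h (k + 1) x y z).continuous.measurable (by positivity)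
      (fun ω => ?_) (fun ω => ?_)
    · rw [hlaw]
      exact TAP.integrable_stdGauss
        ((TAP.hasTemperateGrowth_errorDelta c β h (m₁ ω) (k + 1) x y z).fun_pow 2)
    · rw [hlaw]
      -- The site `x` itself shows `0 < N`; for `N = 0` there is nothing to prove.
      refine (b₁ ⟨c, h, N, x.pos, m₁ ω, fun i => abs_le.2 (hm₁ ω i)⟩ x y z).trans ?_
      gcongr
      linarith
  · intro x
    refine TAP.integrable_sq_and_integral_le hm hY hind
      (TAP.contDiff_errorE c β h (k + 1) x).continuous.measurable (by positivity)
      (fun ω => ?_) (fun ω => ?_)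
    · rw [hlaw]
      exact TAP.integrable_stdGauss
        ((TAP.hasTemperateGrowth_errorE c β h (m₁ ω) (k + 1) x).fun_pow 2)
    · rw [hlaw]
      refine (b₂ ⟨c, h, N, x.pos, m₁ ω, fun i => abs_le.2 (hm₁ ω i)⟩ x).trans ?_
      gcongr
      linarith
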